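/- Let $\Bbbk$ be an algebraically closed field of characteristic $0$, and let $\mathcal{D}$ be the (double of the Jordan plane) unital associative $\Bbbk$-algebra presented by generators $u, v, \zeta, g, g^{-1}, x, y$ and relations $$g g^{-1} = g^{-1} g = 1,\quad \zeta g = g\zeta,\quad gx = xg,\quad gy = yg + xg,\quad \zeta y = y\zeta + y,\quad \zeta x = x\zeta + x,$$ $$ug = gu,\quad vg = gv + gu,\quad v\zeta = \zeta v + v,\quad u\zeta = \zeta u + u,\quad yx = xy - \tfrac12 x^2,\quad vu = uv - \tfrac12 u^2,$$ $$ux = xu,\quad vx = xv + (1-g) + xu,\quad uy = yu + (1-g),\quad vy = yv - g\zeta + yu.$$ For a commutative ring $R$ and $n \ge 0$ let $A_n(R)$ be the Weyl algebra, i.e. the $R$-algebra generated by $p_1,\dots,p_n,q_1,\dots,q_n$ with relations $p_iq_j - q_jp_i = \delta_{ij}$, $p_ip_j = p_jp_i$, $q_iq_j = q_jq_i$. For a (left and right) noetherian domain $A$ let $\operatorname{Frac} A$ be its skew field of fractions (the Ore localization of $A$ at its nonzero elements). For integers $n, s \ge 0$ the Weyl skew field is $\mathscr{D}_{n,s}(\Bbbk)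 := \operatorname{Frac} A_n(\Bbbk(z_1,\dots,z_s))$, where $\Bbbk(z_1,\dots,z_s)$ is the purely transcendental extension of $\Bbbk$ of degree $s$. Then $\mathcal{D}$ and $A_2(\Bbbk(z_1,z_2))$ are noetherian domains, and $\operatorname{Frac}\mathcal{D}$ is isomorphic, as a $\Bbbk$-algebra, to the Weyl skew field $\mathscr{D}_{2,2}(\Bbbk)$. Hence $\mathcal{D}$ satisfies the Gelfand–Kirillov property: it is a noetherian domain whose skew field of fractions is isomorphic as a $\Bbbk$-algebra to $\mathscr{D}_{n,s}(\Bbbk)$ for some integers $n \ge 1$, $s \ge 0$. -/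

import Mathlib

open scoped nonZeroDivisors

/-! ### The double of the Jordan plane -/

/-- The generators `u, v, ζ, g, g⁻¹, x, y` of the double of the Jordan plane. -/
inductive JordanGen : Type
  | u | v | zeta | g | gInv | x | y

namespace JordanGen

/-- The generators as elements of the free `k`-algebra. -/
abbrev X (k : Type*) [Field k] (a : JordanGen) : FreeAlgebra k JordanGen := FreeAlgebra.ι k a

end JordanGen

open JordanGen in
/-- The defining relations of the double of the Jordan plane. -/
inductive JordanDoubleRel (k : Type*) [Field k] :
    FreeAlgebra k JordanGen → FreeAlgebra k JordanGen → Prop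
  | g_gInv : JordanDoubleRel k (X k g * X k gInv) 1
  | gInv_g : JordanDoubleRel k (X k gInv * X k g) 1
  | zeta_g : JordanDoubleRel k (X k zeta * X k g) (X k g * X k zeta)
  | g_x : JordanDoubleRel k (X k g * X k x) (X k x * X k g)
  | g_y : JordanDoubleRel k (X k g * X k y) (X k y * X k g + X k x * X k g)
  | zeta_y : JordanDoubleRel k (X k zeta * X k y) (X k y * X k zeta + X k y)
  | zeta_x : JordanDoubleRel k (X k zeta * X k x) (X k x * X k zeta + X k x)
  | u_g : JordanDoubleRel k (X k u * X k g) (X k g * X k u)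
  | v_g : JordanDoubleRel k (X k v * X k g) (X k g * X k v + X k g * X k u)
  | v_zeta : JordanDoubleRel k (X k v * X k zeta) (X k zeta * X k v + X k v)
  | u_zeta : JordanDoubleRel k (X k u * X k zeta) (X k zeta * X k u + X k u)
  | y_x : JordanDoubleRel k (X k y * X k x) (X k x * X k y - (1 / 2 : k) • X k x ^ 2)
  | v_u : JordanDoubleRel k (X k v * X k u) (X k u * X k v - (1 / 2 : k) • X k u ^ 2)
  | u_x : JordanDoubleRel k (X k u * X k x) (X k x * X k u)
  | v_x : JordanDoubleRel k (X k v * X k x) (X k x * X k v + (1 - X k g) + X k x * X k u)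
  | u_y : JordanDoubleRel k (X k u * X k y) (X k y * X k u + (1 - X k g))
  | v_y : JordanDoubleRel k (X k v * X k y) (X k y * X k v - X k g * X k zeta + X k y * X k u)

/-- The `k`-algebra `𝒟`, the double of the Jordan plane, given by generators and relations. -/
abbrev JordanDouble (k : Type*) [Field k] : Type _ := RingQuot (JordanDoubleRel k)

/-! ### Weyl algebras -/

/-- The generators `p₁, …, pₙ, q₁, …, qₙ` of the `n`-th Weyl algebra. -/
inductive WeylGen (n : ℕ) : Type
  | p (i : Fin n)
  | q (i : Fin n)

/-- The defining relations of the `n`-th Weyl algebra over a commutative ring `R`. -/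
inductive WeylRel (n : ℕ) (R : Type*) [CommRing R] :
    FreeAlgebra R (WeylGen n) → FreeAlgebra R (WeylGen n) → Prop
  | p_q (i : Fin n) : WeylRel n R
      (FreeAlgebra.ι R (.p i) * FreeAlgebra.ι R (.q i) -
        FreeAlgebra.ι R (.q i) * FreeAlgebra.ι R (.p i)) 1
  | p_q_comm (i j : Fin n) (h : i ≠ j) : WeylRel n R
      (FreeAlgebra.ι R (.p i) * FreeAlgebra.ι R (.q j))
      (FreeAlgebra.ι R (.q j) * FreeAlgebra.ι R (.p i))
  | p_p_comm (i j : Fin n) : WeylRel n R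
      (FreeAlgebra.ι R (.p i) * FreeAlgebra.ι R (.p j))
      (FreeAlgebra.ι R (.p j) * FreeAlgebra.ι R (.p i))
  | q_q_comm (i j : Fin n) : WeylRel n R
      (FreeAlgebra.ι R (.q i) * FreeAlgebra.ι R (.q j))
      (FreeAlgebra.ι R (.q j) * FreeAlgebra.ι R (.q i))

/-- The Weyl algebra `Aₙ(R)`. -/
abbrev WeylAlgebra (n : ℕ) (R : Type*) [CommRing R] : Type _ := RingQuot (WeylRel n R)

/-! ### Noetherian domains and their skew fields of fractions -/

/-- A (two-sided) noetherian, not necessarily commutative, domain. -/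
class IsNoetherianDomain (A : Type*) [Ring A] : Prop where
  isDomain : IsDomain A
  left_noetherian : IsNoetherianRing A
  right_noetherian : IsNoetherianRing Aᵐᵒᵖ

attribute [instance] IsNoetherianDomain.isDomain

/-- The left Ore condition in a noetherian domain. -/
theorem IsNoetherianDomain.exists_ore (A : Type*) [Ring A] [h : IsNoetherianDomain A]
    (r : A) (s : A⁰) : ∃ (r' : A) (s' : A⁰), (s' : A) * r = r' * (s : A) := by
  have := h.left_noetherian
  have hs : (s : A) ≠ 0 := nonZeroDivisors.ne_zero s.2
  have hdep : ¬ LinearIndependent A ![r, (s : A)] := by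
    intro hli
    have := hli.fintype_card_le_finrank
    simp at this
  rw [LinearIndependent.pair_iff] at hdep
  push Not at hdep
  obtain ⟨a, b, hab, hne⟩ := hdep
  simp only [smul_eq_mul] at hab
  have ha : a ≠ 0 := by
    intro ha
    rw [ha, zero_mul, zero_add] at hab
    exact hne ha ((mul_eq_zero.mp hab).resolve_right hs)
  refine ⟨-b, ⟨a, mem_nonZeroDivisors_of_ne_zero ha⟩, ?_⟩
  simpa [neg_mul] using eq_neg_of_add_eq_zero_left hab

/-- The nonzero elements of a noetherian domain form an Ore set. -/
noncomputable instance IsNoetherianDomain.oreSet (A : Type*) [Ring A] [IsNoetherianDomain A] :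
    OreLocalization.OreSet A⁰ where
  ore_right_cancel r₁ r₂ s h :=
    ⟨1, by rw [mul_right_cancel₀ (nonZeroDivisors.ne_zero s.2) h]⟩
  oreNum r s := (IsNoetherianDomain.exists_ore A r s).choose
  oreDenom r s := (IsNoetherianDomain.exists_ore A r s).choose_spec.choose
  ore_eq r s := (IsNoetherianDomain.exists_ore A r s).choose_spec.choose_spec

/-- The skew field of fractions `Frac A` of a noetherian domain `A`: the Ore localization of `A` at
its nonzero elements. -/
abbrev SkewFrac (A : Type*) [Ring A] [IsNoetherianDomain A] : Type _ := OreLocalization A⁰ A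

/-! ### Weyl skew fields and the Gelfand–Kirillov property -/

/-- The purely transcendental extension `k(z₁, …, zₛ)`. -/
abbrev RatFuncField (s : ℕ) (k : Type*) [Field k] : Type _ := FractionRing (MvPolynomial (Fin s) k)

/-- The Weyl skew field `𝒟ₙ,ₛ(k) = Frac Aₙ(k(z₁, …, zₛ))`. -/
abbrev WeylSkewField (n s : ℕ) (k : Type*) [Field k]
    [IsNoetherianDomain (WeylAlgebra n (RatFuncField s k))] : Type _ :=
  SkewFrac (WeylAlgebra n (RatFuncField s k))

/-- `A` and `Aₙ(k(z₁, …, zₛ))` are noetherian domains, so that `Frac A` and `𝒟ₙ,ₛ(k)` exist, and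
these two skew fields are isomorphic as `k`-algebras. -/
def FracIsoWeylSkewField (k : Type*) [Field k] (A : Type*) [Ring A] [Algebra k A]
    (n s : ℕ) : Prop :=
  ∃ (_ : IsNoetherianDomain A) (_ : IsNoetherianDomain (WeylAlgebra n (RatFuncField s k))),
    Nonempty (SkewFrac A ≃ₐ[k] WeylSkewField n s k)

/-- The Gelfand–Kirillov property of a `k`-algebra `A`: it is a noetherian domain whose skew field
of fractions is `k`-isomorphic to a Weyl skew field `𝒟ₙ,ₛ(k)` with `n ≥ 1` and `s ≥ 0`. -/
def GelfandKirillovProperty (k : Type*) [Field k] (A : Type*) [Ring A] [Algebra k A] : Prop :=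
  ∃ n s : ℕ, 1 ≤ n ∧ FracIsoWeylSkewField k A n s

/-! `𝒟` acts faithfully on Laurent polynomials in `X₀, …, X₃` by differential operators of order at
most one in `X₀, X₁`. With `Eⱼ = Xⱼ∂ⱼ` and `G = X₁²X₂`, let `x ↦ X₀`, `ζ ↦ E₀`, `g ↦ G`, `y ↦
-½X₀(E₀ + E₁)` and `u ↦ X₀⁻¹W`. The relation for `uy` asks for `E₁W - W = 2 - 2G`, which `W = X₁ - 2
- 2G` solves. The relations for `vx` and `vg` fix the coefficients of `E₀` and `E₁` in `v`. Those
for `vζ` and `vy` fix its order-zero term up to `X₀⁻¹X₁` times a constant of `E₀, E₁`, and `X₃` is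
put there. Since `E₂, E₃` do not occur, `X₂` and `X₃` are central parameters.

The image generates the same skew field as all Laurent differential operators in `E₀, E₁`
(`subfield_eq_top_of_jordanRep_mem`): `X₁ = xu + 2 + 2g`, and then `X₂`, `E₁`, `X₃` follow by
division. That skew field is also `𝒟₂,₂(k)`, because `Xᵢ, ∂ᵢ` for `i = 0, 1` form a Weyl system over
`k(X₂, X₃)` (`weylSkewFieldEquiv`).

One device replaces bases of PBW type, both for injectivity (`eq_zero_of_mem_adjoin_insert`) and for
the absence of zero divisors (`mul_eq_zero_of_mem_adjoin_insert`). Generators are adjoined one at a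
time. If `c` commutes with the old ones and `e = [c, t]` is a unit commuting with `c`, the `n`-th
iterate of `[c, ·]` sends a polynomial of degree `n` in the new generator `t` to `n! eⁿ` times its
leading coefficient. In characteristic `0` this detects the coefficient. Noetherianity comes from a
Hilbert basis theorem along the same chains (`isNoetherianRing_of_rightPolyLT`). -/

/-! ### Hilbert basis theorem for polynomials with right coefficients. -/

section RightPolynomials

variable {R B : Type*} [Ring R] [Ring B]

/-- The additive subgroup of the elements `∑ i < n, t ^ i * r i` with coefficients from `R`. -/
def rightPolyLT (i : R →+* B) (t : B) : ℕ → AddSubgroup B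
  | 0 => ⊥
  | n + 1 => rightPolyLT i t n ⊔ i.range.toAddSubgroup.map (AddMonoidHom.mulLeft (t ^ n))

variable {i : R →+* B} {t : B}

theorem mem_rightPolyLT_succ {n : ℕ} {x : B} :
    x ∈ rightPolyLT i t (n + 1) ↔ ∃ f ∈ rightPolyLT i t n, ∃ r, f + t ^ n * i r = x := by
  simp [rightPolyLT, AddSubgroup.mem_sup]

theorem mem_rightPolyLT_zero {x : B} : x ∈ rightPolyLT i t 0 ↔ x = 0 := by
  simp [rightPolyLT]

theorem rightPolyLT_mono : Monotone (rightPolyLT i t) :=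
  monotone_nat_of_le_succ fun _ _ h => mem_rightPolyLT_succ.2 ⟨_, h, 0, by simp⟩

theorem pow_mul_mem_rightPolyLT (n : ℕ) (r : R) : t ^ n * i r ∈ rightPolyLT i t (n + 1) :=
  mem_rightPolyLT_succ.2 ⟨0, zero_mem _, r, by simp⟩

theorem mem_rightPolyLT_one (r : R) : i r ∈ rightPolyLT i t 1 := by
  simpa using pow_mul_mem_rightPolyLT (i := i) (t := t) 0 r

theorem rightPolyLT_mul_mem {n : ℕ} {x : B} (hx : x ∈ rightPolyLT i t n) (a : R) :
    x * i a ∈ rightPolyLT i t n := by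
  induction n generalizing x with
  | zero => simp_all [mem_rightPolyLT_zero]
  | succ n ih =>
    obtain ⟨f, hf, r, rfl⟩ := mem_rightPolyLT_succ.1 hx
    exact mem_rightPolyLT_succ.2 ⟨f * i a, ih hf, r * a, by simp [add_mul, mul_assoc]⟩

theorem mul_rightPolyLT_mem {n : ℕ} {x : B} (hx : x ∈ rightPolyLT i t n) :
    t * x ∈ rightPolyLT i t (n + 1) := by
  induction n generalizing x with
  | zero => simp_all [mem_rightPolyLT_zero]
  | succ n ih =>
    obtain ⟨f, hf, r, rfl⟩ := mem_rightPolyLT_succ.1 hx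
    exact mem_rightPolyLT_succ.2 ⟨t * f, ih hf, r, by simp [mul_add, mul_assoc, pow_succ']⟩

/-- Each passage of a coefficient across one `t` costs only a term without that `t`, so crossing `t
^ n` leaves an error of lower degree. -/
theorem exists_mul_pow_eq (h : ∀ a, ∃ b c, i a * t = t * i b + i c) (n : ℕ) (a : R) :
    ∃ b, ∃ f ∈ rightPolyLT i t n, i a * t ^ n = f + t ^ n * i b := by
  induction n generalizing a with
  | zero => exact ⟨a, 0, zero_mem _, by simp⟩
  | succ n ih =>
    obtain ⟨b, c, hbc⟩ := h a
    obtain ⟨b', f, hf, hb'⟩ := ih b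
    obtain ⟨c', f', hf', hc'⟩ := ih c
    refine ⟨b', t * f + (f' + t ^ n * i c'), add_mem (mul_rightPolyLT_mem hf)
      (mem_rightPolyLT_succ.2 ⟨f', hf', c', rfl⟩), ?_⟩
    rw [pow_succ', ← mul_assoc, hbc, add_mul, mul_assoc, hb', hc']
    simp only [mul_add, mul_assoc]
    abel

theorem coeff_mul_rightPolyLT_mem (h : ∀ a, ∃ b c, i a * t = t * i b + i c) {n : ℕ} {x : B}
    (hx : x ∈ rightPolyLT i t n) (a : R) : i a * x ∈ rightPolyLT i t n := by
  induction n generalizing x with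
  | zero => simp_all [mem_rightPolyLT_zero]
  | succ n ih =>
    obtain ⟨f, hf, r, rfl⟩ := mem_rightPolyLT_succ.1 hx
    obtain ⟨b, f', hf', hb⟩ := exists_mul_pow_eq h n a
    refine mem_rightPolyLT_succ.2 ⟨i a * f + f' * i r, add_mem (ih hf)
      (rightPolyLT_mul_mem hf' r), b * r, ?_⟩
    rw [mul_add, ← mul_assoc (i a), hb, add_mul, map_mul, mul_assoc (t ^ n), add_assoc]

/-- Coefficients stand on the right, so to multiply a leading coefficient by `a` on the left one
must find the `b` that becomes `a` after crossing `t ^ n`. This makes leading coefficients a left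
ideal. -/
theorem exists_pow_mul_eq (h : ∀ a, ∃ b c, i a * t = t * i b + i c)
    (h' : ∀ a, ∃ b c, t * i a = i b * t + i c) (n : ℕ) (a : R) :
    ∃ b, ∃ f ∈ rightPolyLT i t n, i b * t ^ n = f + t ^ n * i a := by
  induction n generalizing a with
  | zero => exact ⟨a, 0, zero_mem _, by simp⟩
  | succ n ih =>
    obtain ⟨b, f, hf, hb⟩ := ih a
    obtain ⟨b', c, hbc⟩ := h' b
    obtain ⟨c', f', hf', hc'⟩ := exists_mul_pow_eq h n c
    refine ⟨b', t * f + -(i c * t ^ n), add_mem (mul_rightPolyLT_mem hf)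
      (neg_mem (hc' ▸ mem_rightPolyLT_succ.2 ⟨f', hf', c', rfl⟩)), ?_⟩
    have h1 : i b' * t = t * i b - i c := by rw [hbc]; abel
    rw [pow_succ', ← mul_assoc, h1, sub_mul, mul_assoc, hb]
    simp only [mul_add, mul_assoc]
    abel

/-- The leading coefficients of the elements of degree `n` in a left ideal. -/
def leadingCoeffIdeal (h : ∀ a, ∃ b c, i a * t = t * i b + i c)
    (h' : ∀ a, ∃ b c, t * i a = i b * t + i c) (I : Ideal B) (n : ℕ) : Ideal R where
  carrier := {r | ∃ f ∈ rightPolyLT i t n, f + t ^ n * i r ∈ I}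
  zero_mem' := ⟨0, zero_mem _, by simp⟩
  add_mem' := by
    rintro r r' ⟨f, hf, hI⟩ ⟨f', hf', hI'⟩
    refine ⟨f + f', add_mem hf hf', ?_⟩
    convert I.add_mem hI hI' using 1
    rw [map_add, mul_add]
    abel
  smul_mem' := by
    rintro a r ⟨f, hf, hI⟩
    obtain ⟨b, f', hf', hb⟩ := exists_pow_mul_eq h h' n a
    refine ⟨i b * f + f' * i r, add_mem (coeff_mul_rightPolyLT_mem h hf b)
      (rightPolyLT_mul_mem hf' r), ?_⟩
    convert I.mul_mem_left (i b) hI using 1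
    rw [mul_add, ← mul_assoc (i b), hb, add_mul, smul_eq_mul, map_mul, mul_assoc (t ^ n), add_assoc]

/-- Left multiplication by `t` raises the degree and keeps the leading coefficient. -/
theorem leadingCoeffIdeal_mono (h : ∀ a, ∃ b c, i a * t = t * i b + i c)
    (h' : ∀ a, ∃ b c, t * i a = i b * t + i c) {I J : Ideal B} (hIJ : I ≤ J) {m n : ℕ}
    (hmn : m ≤ n) : leadingCoeffIdeal h h' I m ≤ leadingCoeffIdeal h h' J n := by
  induction n, hmn using Nat.le_induction with
  | base => exact fun r ⟨f, hf, hI⟩ => ⟨f, hf, hIJ hI⟩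
  | succ n _ ih =>
    intro r hr
    obtain ⟨f, hf, hJ⟩ := ih hr
    refine ⟨t * f, mul_rightPolyLT_mem hf, ?_⟩
    convert J.mul_mem_left t hJ using 1
    rw [mul_add, pow_succ', mul_assoc]

/-- Subtracting an element of `I` with the same leading term lowers the degree inside `J`. -/
theorem le_of_leadingCoeffIdeal_le (h : ∀ a, ∃ b c, i a * t = t * i b + i c)
    (h' : ∀ a, ∃ b c, t * i a = i b * t + i c) (htop : ∀ x, ∃ n, x ∈ rightPolyLT i t n)
    {I J : Ideal B} (hIJ : I ≤ J)
    (hle : ∀ n, leadingCoeffIdeal h h' J n ≤ leadingCoeffIdeal h h' I n) : J ≤ I := by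
  intro x hx
  obtain ⟨n, hn⟩ := htop x
  induction n generalizing x with
  | zero => simp_all [mem_rightPolyLT_zero]
  | succ n ih =>
    obtain ⟨f, hf, r, rfl⟩ := mem_rightPolyLT_succ.1 hn
    obtain ⟨f', hf', hI⟩ := hle n ⟨f, hf, hx⟩
    have h1 : f - f' ∈ I := by
      refine ih (x := f - f') ?_ (sub_mem hf hf')
      convert J.sub_mem hx (hIJ hI) using 1
      abel
    convert I.add_mem h1 hI using 1
    abel

/-- The Hilbert basis theorem for an extension of a ring by a normalizing element. -/
theorem isNoetherianRing_of_rightPolyLT [IsNoetherianRing R]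
    (h : ∀ a, ∃ b c, i a * t = t * i b + i c) (h' : ∀ a, ∃ b c, t * i a = i b * t + i c)
    (htop : ∀ x, ∃ n, x ∈ rightPolyLT i t n) : IsNoetherianRing B := by
  rw [isNoetherianRing_iff, ← monotone_stabilizes_iff_noetherian]
  intro f
  have stab : ∀ g : ℕ →o Ideal R, ∃ n, ∀ m, n ≤ m → g n = g m :=
    monotone_stabilizes_iff_noetherian.2 inferInstance
  -- The diagonal of the doubly increasing family of ideals controls all degrees from `N` on; the
  -- finitely many smaller degrees stabilize separately, at `M n`.
  obtain ⟨N, hN⟩ := stab ⟨fun j => leadingCoeffIdeal h h' (f j) j,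
    fun a b hab => leadingCoeffIdeal_mono h h' (f.monotone hab) hab⟩
  choose M hM using fun n => stab ⟨fun j => leadingCoeffIdeal h h' (f j) n,
    fun a b hab => leadingCoeffIdeal_mono h h' (f.monotone hab) le_rfl⟩
  refine ⟨N ⊔ (Finset.range N).sup M, fun m hm => le_antisymm (f.monotone hm) ?_⟩
  refine le_of_leadingCoeffIdeal_le h h' htop (f.monotone hm) fun n => ?_
  have hNm := le_sup_left.trans hm
  by_cases hn : n < N
  · have h1 : M n ≤ N ⊔ (Finset.range N).sup M :=
      (Finset.le_sup (f := M) (Finset.mem_range.2 hn)).trans le_sup_right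
    exact ((hM n _ (h1.trans hm)).symm.trans (hM n _ h1)).le
  · rw [not_lt] at hn
    calc leadingCoeffIdeal h h' (f m) n ≤ leadingCoeffIdeal h h' (f (m ⊔ n)) (m ⊔ n) :=
          leadingCoeffIdeal_mono h h' (f.monotone le_sup_left) le_sup_right
      _ = leadingCoeffIdeal h h' (f N) N := (hN _ (hNm.trans le_sup_left)).symm
      _ ≤ _ := leadingCoeffIdeal_mono h h' (f.monotone le_sup_left) hn

end RightPolynomials

/-! ### Chains of normalizing generators and two-sided noetherianity. -/

section NormalizingChain

open Algebra

variable {k A : Type*} [Field k] [Ring A] [Algebra k A]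

theorem mem_rightPolyLT_of_map {R B C : Type*} [Ring R] [Ring B] [Ring C] {i : R →+* B} {t : B}
    {j : B →+* C} {n : ℕ} {x : B} (hj : Function.Injective j)
    (hx : j x ∈ rightPolyLT (j.comp i) (j t) n) : x ∈ rightPolyLT i t n := by
  induction n generalizing x with
  | zero =>
    rw [mem_rightPolyLT_zero] at hx ⊢
    exact hj (by simpa using hx)
  | succ n ih =>
    obtain ⟨f, hf, r, hr⟩ := mem_rightPolyLT_succ.1 hx
    refine mem_rightPolyLT_succ.2 ⟨x - t ^ n * i r, ih ?_, r, by simp⟩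
    convert hf
    simp [← hr]

/-- Right and left multiplication by `a` moves past `t`, up to elements of the subalgebra
generated by `s`. -/
structure NormalizesAt (k : Type*) {A : Type*} [Field k] [Ring A] [Algebra k A] (s : Set A)
    (t a : A) : Prop where
  left : ∃ b ∈ adjoin k s, ∃ c ∈ adjoin k s, t * a = b * t + c
  right : ∃ b ∈ adjoin k s, ∃ c ∈ adjoin k s, a * t = t * b + c

theorem NormalizesAt.of_commutator {s : Set A} {t a : A} (ha : a ∈ adjoin k s)
    (h : t * a - a * t ∈ adjoin k s) : NormalizesAt k s t a :=
  ⟨⟨a, ha, _, h, by abel⟩, ⟨a, ha, _, neg_mem h, by abel⟩⟩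

theorem NormalizesAt.of_commute {s : Set A} {t a : A} (ha : a ∈ adjoin k s)
    (h : t * a = a * t) : NormalizesAt k s t a :=
  .of_commutator ha (by simp [h])

/-- Serves for `a = ζ`: there `[t, a]` is a multiple of `t` itself, not an old element, and is
absorbed by shifting `a` by a scalar. -/
theorem NormalizesAt.of_eq_add_mul {s : Set A} {t a : A} (ha : a ∈ adjoin k s) (r : k)
    (h : t * a = (a + algebraMap k A r) * t) : NormalizesAt k s t a :=
  ⟨⟨_, add_mem ha (algebraMap_mem _ r), 0, zero_mem _, by simp [h]⟩,
    ⟨_, sub_mem ha (algebraMap_mem _ r), 0, zero_mem _, by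
      rw [mul_sub, h, ← Algebra.commutes r t]
      simp [add_mul]⟩⟩

theorem NormalizesAt.of_mul_eq_add {s : Set A} {t a : A} (ha : a ∈ adjoin k s)
    (h : a * t = t * a + t) : NormalizesAt k s t a :=
  .of_eq_add_mul ha (-1) (by simp [add_mul, h])

/-- The condition is stable under sums and products, so it need only be checked on generators. -/
theorem NormalizesAt.exists_right {s : Set A} {t : A} (h : ∀ a ∈ s, NormalizesAt k s t a)
    (a : adjoin k s) : ∃ b c : adjoin k s, (a : A) * t = t * b + c := by
  obtain ⟨a, ha⟩ := a
  induction ha using adjoin_induction with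
  | mem x hx =>
    obtain ⟨b, hb, c, hc, e⟩ := (h x hx).right
    exact ⟨⟨b, hb⟩, ⟨c, hc⟩, e⟩
  | algebraMap r => exact ⟨⟨_, algebraMap_mem _ r⟩, 0, by simp [Algebra.commutes r t]⟩
  | add x y _ _ hx hy =>
    obtain ⟨b, c, e⟩ := hx
    obtain ⟨b', c', e'⟩ := hy
    refine ⟨b + b', c + c', ?_⟩
    simp only at e e'
    simp only [add_mul, e, e', Subalgebra.coe_add, mul_add]
    abel
  | mul x y hx hy h1 h2 =>
    obtain ⟨b, c, e⟩ := h1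
    obtain ⟨b', c', e'⟩ := h2
    refine ⟨b * b', c * b' + ⟨x, hx⟩ * c', ?_⟩
    simp only at e e'
    simp only [Subalgebra.coe_add, Subalgebra.coe_mul]
    rw [mul_assoc, e', mul_add, ← mul_assoc, e]
    noncomm_ring

theorem NormalizesAt.exists_left {s : Set A} {t : A} (h : ∀ a ∈ s, NormalizesAt k s t a)
    (a : adjoin k s) : ∃ b c : adjoin k s, t * (a : A) = b * t + c := by
  obtain ⟨a, ha⟩ := a
  induction ha using adjoin_induction with
  | mem x hx =>
    obtain ⟨b, hb, c, hc, e⟩ := (h x hx).left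
    exact ⟨⟨b, hb⟩, ⟨c, hc⟩, e⟩
  | algebraMap r => exact ⟨⟨_, algebraMap_mem _ r⟩, 0, by simp [Algebra.commutes r t]⟩
  | add x y _ _ hx hy =>
    obtain ⟨b, c, e⟩ := hx
    obtain ⟨b', c', e'⟩ := hy
    refine ⟨b + b', c + c', ?_⟩
    simp only at e e'
    simp only [add_mul, e, e', Subalgebra.coe_add, mul_add]
    abel
  | mul x y hx hy h1 h2 =>
    obtain ⟨b, c, e⟩ := h1
    obtain ⟨b', c', e'⟩ := h2
    refine ⟨b * b', b * c' + c * ⟨y, hy⟩, ?_⟩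
    simp only at e e'
    simp only [Subalgebra.coe_add, Subalgebra.coe_mul]
    rw [← mul_assoc, e, add_mul, mul_assoc, e']
    noncomm_ring

/-- Every element generated by `s` and a normalizing element `t` is a polynomial in `t`. -/
theorem exists_mem_rightPolyLT {s : Set A} {t : A} (h : ∀ a ∈ s, NormalizesAt k s t a) {x : A}
    (hx : x ∈ adjoin k (insert t s)) :
    ∃ n, x ∈ rightPolyLT (adjoin k s).val.toRingHom t n := by
  have hr : ∀ a : adjoin k s, ∃ b c : adjoin k s, (adjoin k s).val.toRingHom a * t =
    t * (adjoin k s).val.toRingHom b + (adjoin k s).val.toRingHom c := NormalizesAt.exists_right h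
  have hcoeff : ∀ a ∈ adjoin k s, ∀ n, ∀ f ∈ rightPolyLT (adjoin k s).val.toRingHom t n,
      a * f ∈ rightPolyLT (adjoin k s).val.toRingHom t n :=
    fun a ha n f hf => coeff_mul_rightPolyLT_mem hr hf ⟨a, ha⟩
  -- Stability of the polynomials in `t` under left multiplication by `x` is what the induction on
  -- `x` can carry; the claim is the case `f = 1`.
  have key : ∀ n, ∀ f ∈ rightPolyLT (adjoin k s).val.toRingHom t n,
      ∃ m, x * f ∈ rightPolyLT (adjoin k s).val.toRingHom t m := by
    induction hx using adjoin_induction with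
    | mem x hx =>
      rintro n f hf
      rcases hx with rfl | hx
      · exact ⟨n + 1, mul_rightPolyLT_mem hf⟩
      · exact ⟨n, hcoeff x (subset_adjoin hx) n f hf⟩
    | algebraMap r => exact fun n f hf => ⟨n, hcoeff _ (algebraMap_mem _ r) n f hf⟩
    | add x y _ _ hx hy =>
      intro n f hf
      obtain ⟨m, hm⟩ := hx n f hf
      obtain ⟨m', hm'⟩ := hy n f hf
      rw [add_mul]
      exact ⟨m ⊔ m', add_mem (rightPolyLT_mono le_sup_left hm) (rightPolyLT_mono le_sup_right hm')⟩
    | mul x y _ _ hx hy =>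
      intro n f hf
      obtain ⟨m, hm⟩ := hy n f hf
      obtain ⟨m', hm'⟩ := hx m _ hm
      exact ⟨m', by rwa [mul_assoc]⟩
  simpa using key 1 1 (by simpa using mem_rightPolyLT_one (i := (adjoin k s).val.toRingHom) 1)

/-- Finite sets obtained by successively adding elements that normalize the subalgebra generated by
the previous ones. -/
inductive IsNormalizingChain (k : Type*) {A : Type*} [Field k] [Ring A] [Algebra k A] :
    Set A → Prop
  | empty : IsNormalizingChain k ∅
  | cons {s : Set A} {t : A} (hs : IsNormalizingChain k s)
      (h : ∀ a ∈ s, NormalizesAt k s t a) : IsNormalizingChain k (insert t s)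

theorem IsNormalizingChain.isNoetherianRing_adjoin {s : Set A} (hs : IsNormalizingChain k s) :
    IsNoetherianRing (adjoin k s) := by
  induction hs with
  | empty =>
    rw [adjoin_empty]
    exact isNoetherianRing_of_surjective k _ (algebraMap k (⊥ : Subalgebra k A))
      fun ⟨x, hx⟩ => by
        obtain ⟨r, rfl⟩ := Algebra.mem_bot.1 hx
        exact ⟨r, rfl⟩
  | @cons s t _ h ih =>
    let i := (Subalgebra.inclusion (adjoin_mono (R := k) (Set.subset_insert t s))).toRingHom
    let t' : adjoin k (insert t s) := ⟨t, subset_adjoin (Set.mem_insert t s)⟩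
    refine isNoetherianRing_of_rightPolyLT (i := i) (t := t') (fun a => ?_) (fun a => ?_)
      fun x => ?_
    · obtain ⟨b, c, e⟩ := NormalizesAt.exists_right h a
      exact ⟨b, c, Subtype.ext e⟩
    · obtain ⟨b, c, e⟩ := NormalizesAt.exists_left h a
      exact ⟨b, c, Subtype.ext e⟩
    · obtain ⟨n, hn⟩ := exists_mem_rightPolyLT h x.2
      exact ⟨n, mem_rightPolyLT_of_map (j := (adjoin k (insert t s)).val.toRingHom)
        Subtype.val_injective hn⟩

/-- Passing to the opposite ring exchanges the two fields of `NormalizesAt`, so a single chain gives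
noetherianity on both sides. -/
theorem NormalizesAt.op {s : Set A} {t a : A} (h : NormalizesAt k s t a) :
    NormalizesAt k (MulOpposite.unop ⁻¹' s) (MulOpposite.op t) (MulOpposite.op a) := by
  obtain ⟨⟨b, hb, c, hc, e⟩, ⟨b', hb', c', hc', e'⟩⟩ := h
  refine ⟨⟨.op b', ?_, .op c', ?_, ?_⟩, ⟨.op b, ?_, .op c, ?_, ?_⟩⟩
  all_goals first
    | (rw [← Subalgebra.op_adjoin]; assumption)
    | (apply MulOpposite.unop_injective; simpa)

theorem IsNormalizingChain.op {s : Set A} (hs : IsNormalizingChain k s) :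
    IsNormalizingChain k (MulOpposite.unop ⁻¹' s) := by
  induction hs with
  | empty => exact .empty
  | @cons s t _ h ih =>
    have : MulOpposite.unop ⁻¹' (insert t s) =
        insert (MulOpposite.op t) (MulOpposite.unop ⁻¹' s) := by
      ext x
      simp [← MulOpposite.unop_inj]
    rw [this]
    exact .cons ih fun a ha => (h _ ha).op

theorem IsNormalizingChain.isNoetherianRing {s : Set A} (hs : IsNormalizingChain k s)
    (htop : adjoin k s = ⊤) : IsNoetherianRing A := by
  have := hs.isNoetherianRing_adjoin
  rw [htop] at this
  exact isNoetherianRing_of_ringEquiv _ (Subalgebra.topEquiv (R := k) (A := A)).toRingEquiv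

theorem IsNormalizingChain.isNoetherianDomain [IsDomain A] {s : Set A}
    (hs : IsNormalizingChain k s) (htop : adjoin k s = ⊤) : IsNoetherianDomain A where
  isDomain := inferInstance
  left_noetherian := hs.isNoetherianRing htop
  right_noetherian := hs.op.isNoetherianRing (by rw [← Subalgebra.op_adjoin, htop]; rfl)

end NormalizingChain

/-! ### Reading off leading coefficients by iterated commutators. -/

section CommutatorDegree

open Algebra

variable {T : Type*} [Ring T]

/-- The inner derivation `x ↦ c * x - x * c`. -/
def innerDer (c : T) : T →+ T := AddMonoidHom.mulLeft c - AddMonoidHom.mulRight c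

theorem innerDer_apply (c x : T) : innerDer c x = c * x - x * c := rfl

theorem innerDer_mul (c x y : T) :
    innerDer c (x * y) = innerDer c x * y + x * innerDer c y := by
  simp only [innerDer_apply]
  noncomm_ring

theorem innerDer_eq_zero {c x : T} (h : x * c = c * x) : innerDer c x = 0 := by
  rw [innerDer_apply, h, sub_self]

/-- The `n`-th iterate of the inner derivation of `c` at `a` is the constant `α`. -/
def HasTopDer (c a : T) (n : ℕ) (α : T) : Prop :=
  (innerDer c)^[n] a = α ∧ innerDer c α = 0

/-- Leibniz rule: in the `(n + m)`-th derivative only the term with `n` derivations on `a` and `m`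
on `b` survives. The induction is Pascal's rule; when `n` or `m` is `0`, one of its two terms
vanishes. -/
theorem HasTopDer.mul {c a b α β : T} {n m : ℕ} (ha : HasTopDer c a n α)
    (hb : HasTopDer c b m β) : HasTopDer c (a * b) (n + m) ((n + m).choose n • (α * β)) := by
  refine ⟨?_, by rw [map_nsmul, innerDer_mul, ha.2, hb.2]; simp⟩
  induction hN : n + m generalizing n m a b with
  | zero =>
    obtain ⟨rfl, rfl⟩ : n = 0 ∧ m = 0 := by omega
    simp_all [HasTopDer]
  | succ N ih =>
    rw [Function.iterate_succ_apply, innerDer_mul, iterate_map_add]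
    rcases n with _ | n
    · obtain rfl : m = N + 1 := by omega
      have h0 : innerDer c a = 0 := by
        have := ha.2
        rwa [← ha.1] at this
      rw [h0, zero_mul, iterate_map_zero, zero_add]
      have h1 : HasTopDer c (innerDer c b) N β :=
        ⟨by rw [← Function.iterate_succ_apply]; exact hb.1, hb.2⟩
      simpa using ih ha h1 (by omega)
    rcases m with _ | m
    · obtain rfl : n = N := by omega
      have h0 : innerDer c b = 0 := by
        have := hb.2
        rwa [← hb.1] at this
      rw [h0, mul_zero, iterate_map_zero, add_zero]
      have h1 : HasTopDer c (innerDer c a) n α :=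
        ⟨by rw [← Function.iterate_succ_apply]; exact ha.1, ha.2⟩
      simpa using ih h1 hb (by omega)
    · have h1 : HasTopDer c (innerDer c a) n α :=
        ⟨by rw [← Function.iterate_succ_apply]; exact ha.1, ha.2⟩
      have h2 : HasTopDer c (innerDer c b) m β :=
        ⟨by rw [← Function.iterate_succ_apply]; exact hb.1, hb.2⟩
      rw [ih h1 hb (by omega), ih ha h2 (by omega), ← add_smul, ← Nat.choose_succ_succ]

theorem HasTopDer.pow {c t e : T} (h : HasTopDer c t 1 e) (n : ℕ) :
    HasTopDer c (t ^ n) n (n.factorial • e ^ n) := by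
  induction n with
  | zero => simp [HasTopDer, innerDer_apply]
  | succ n ih =>
    have h1 := ih.mul h
    rwa [smul_mul_assoc, smul_smul, Nat.choose_succ_self_right, ← Nat.factorial_succ, ← pow_succ,
      ← pow_succ] at h1

theorem HasTopDer.add_of_lt {c a b α : T} {n : ℕ} (ha : HasTopDer c a n α)
    (hb : (innerDer c)^[n] b = 0) : HasTopDer c (b + a) n α :=
  ⟨by rw [iterate_map_add, hb, zero_add, ha.1], ha.2⟩

variable {R : Type*} [Ring R] {i : R →+* T} {t c e : T}

theorem iterate_innerDer_eq_zero (hi : ∀ r, i r * c = c * i r) (ht : HasTopDer c t 1 e) {n : ℕ}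
    {x : T} (hx : x ∈ rightPolyLT i t n) : (innerDer c)^[n] x = 0 := by
  induction n generalizing x with
  | zero => simpa [mem_rightPolyLT_zero] using hx
  | succ n ih =>
    obtain ⟨f, hf, r, rfl⟩ := mem_rightPolyLT_succ.1 hx
    have h1 : HasTopDer c (i r) 0 (i r) := ⟨rfl, innerDer_eq_zero (hi r)⟩
    have h2 := (ht.pow n).mul h1
    rw [Function.iterate_succ_apply', iterate_map_add, ih hf, zero_add]
    have := h2.2
    rwa [← h2.1] at this

theorem hasTopDer_add_pow_mul (hi : ∀ r, i r * c = c * i r) (ht : HasTopDer c t 1 e) {n : ℕ}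
    {f : T} (hf : f ∈ rightPolyLT i t n) (r : R) :
    HasTopDer c (f + t ^ n * i r) n (n.factorial • (e ^ n * i r)) := by
  have h1 : HasTopDer c (i r) 0 (i r) := ⟨rfl, innerDer_eq_zero (hi r)⟩
  have h2 := (ht.pow n).mul h1
  simp only [add_zero, Nat.choose_self, one_smul, smul_mul_assoc] at h2
  exact h2.add_of_lt (iterate_innerDer_eq_zero hi ht hf)

/-- The `n`-th derivative kills `f` and leaves `n! eⁿ` times the leading coefficient. -/
theorem eq_zero_of_add_pow_mul_eq_zero [IsAddTorsionFree T] (hi : ∀ r, i r * c = c * i r)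
    (ht : HasTopDer c t 1 e) (he : IsUnit e) {n : ℕ} {f : T} (hf : f ∈ rightPolyLT i t n) {r : R}
    (h : f + t ^ n * i r = 0) : i r = 0 := by
  have h1 := (hasTopDer_add_pow_mul hi ht hf r).1
  rw [h, iterate_map_zero] at h1
  have h2 := (smul_eq_zero.1 h1.symm).resolve_left n.factorial_ne_zero
  exact (he.pow n).mul_right_eq_zero.1 h2

theorem exists_eq_add_pow_mul {B : Type*} [Ring B] {i : R →+* B} {t x : B} {n : ℕ}
    (hx : x ∈ rightPolyLT i t n) (h0 : x ≠ 0) :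
    ∃ m, ∃ f ∈ rightPolyLT i t m, ∃ r, i r ≠ 0 ∧ x = f + t ^ m * i r := by
  induction n with
  | zero => exact absurd (mem_rightPolyLT_zero.1 hx) h0
  | succ n ih =>
    obtain ⟨f, hf, r, rfl⟩ := mem_rightPolyLT_succ.1 hx
    by_cases hr : i r = 0
    · simp_all
    · exact ⟨n, f, hf, r, hr, rfl⟩

theorem map_mem_rightPolyLT {B : Type*} [Ring B] {i : R →+* B} {t x : B} {n : ℕ} (φ : B →+* T)
    (hx : x ∈ rightPolyLT i t n) : φ x ∈ rightPolyLT (φ.comp i) (φ t) n := by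
  induction n generalizing x with
  | zero => simp_all [mem_rightPolyLT_zero]
  | succ n ih =>
    obtain ⟨f, hf, r, rfl⟩ := mem_rightPolyLT_succ.1 hx
    exact mem_rightPolyLT_succ.2 ⟨φ f, ih hf, r, by simp⟩

end CommutatorDegree

theorem IsAddTorsionFree.of_algebra_field (k : Type*) {T : Type*} [Field k] [CharZero k] [Ring T]
    [Algebra k T] : IsAddTorsionFree T :=
  letI := Module.compHom T (algebraMap ℚ k)
  .of_module_rat T

/-! ### Adjoining one generator: injectivity and absence of zero divisors. -/

section AdjoinSteps

open Algebra

variable {k A T : Type*} [Field k] [Ring A] [Algebra k A] [Ring T] [Algebra k T]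

theorem commute_map_of_mem_adjoin {s : Set A} (φ : A →ₐ[k] T) {c : T}
    (hc : ∀ a ∈ s, φ a * c = c * φ a) {x : A} (hx : x ∈ adjoin k s) : φ x * c = c * φ x := by
  induction hx using adjoin_induction with
  | mem x hx => exact hc x hx
  | algebraMap r => rw [AlgHom.commutes, Algebra.commutes]
  | add x y _ _ hx hy => rw [map_add, add_mul, mul_add, hx, hy]
  | mul x y _ _ hx hy => rw [map_mul, mul_assoc, hy, ← mul_assoc, hx, mul_assoc]

/-- Injectivity on the subalgebra generated by `s` is kept when the inverse of an element of this
subalgebra is adjoined. -/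
theorem eq_zero_of_mem_adjoin_insert_inverse {s : Set A} {t g : A} (φ : A →ₐ[k] T)
    (hinj : ∀ x ∈ adjoin k s, φ x = 0 → x = 0) (h : ∀ a ∈ s, NormalizesAt k s t a)
    (hg : g ∈ adjoin k s) (hgt : g * t = 1) (htg : t * g = 1) :
    ∀ x ∈ adjoin k (insert t s), φ x = 0 → x = 0 := by
  intro x hx h0
  obtain ⟨n, hn⟩ := exists_mem_rightPolyLT h hx
  -- Multiplication by `g ^ n` clears the powers of `t = g⁻¹`.
  have key : ∀ (n : ℕ) (x : A), x ∈ rightPolyLT (adjoin k s).val.toRingHom t n →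
      g ^ n * x ∈ adjoin k s := by
    intro n
    induction n with
    | zero =>
      intro x hx
      rw [mem_rightPolyLT_zero.1 hx, mul_zero]
      exact zero_mem _
    | succ n ih =>
      intro x hx
      obtain ⟨f, hf, r, rfl⟩ := mem_rightPolyLT_succ.1 hx
      have h1 : g ^ (n + 1) * (f + t ^ n * r) = g * (g ^ n * f) + g * r := by
        rw [mul_add, pow_succ', mul_assoc, mul_assoc, ← mul_assoc (g ^ n), pow_mul_pow_eq_one n hgt,
          one_mul]
      exact h1 ▸ add_mem (mul_mem hg (ih f hf)) (mul_mem hg r.2)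
  have h1 : g ^ n * x = 0 := hinj _ (key n x hn) (by rw [map_mul, h0, mul_zero])
  rw [← one_mul x, ← pow_mul_pow_eq_one n htg, mul_assoc, h1, mul_zero]

variable [CharZero k]

/-- An algebra map that is injective on the subalgebra generated by `s` stays injective after
adjoining `t`, if `e = [c, t]` is a unit and `c` commutes with the images of `s` and with `e`. -/
theorem eq_zero_of_mem_adjoin_insert {s : Set A} {t : A} (φ : A →ₐ[k] T)
    (hinj : ∀ x ∈ adjoin k s, φ x = 0 → x = 0) (h : ∀ a ∈ s, NormalizesAt k s t a) (c e : T)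
    (hc : ∀ a ∈ s, φ a * c = c * φ a) (ht : c * φ t - φ t * c = e) (hce : c * e = e * c)
    (he : IsUnit e) : ∀ x ∈ adjoin k (insert t s), φ x = 0 → x = 0 := by
  intro x hx h0
  have : IsAddTorsionFree T := .of_algebra_field k
  by_contra hne
  obtain ⟨n, hn⟩ := exists_mem_rightPolyLT h hx
  obtain ⟨m, f, hf, r, hr, rfl⟩ := exists_eq_add_pow_mul hn hne
  refine hr (hinj _ r.2 (eq_zero_of_add_pow_mul_eq_zero (T := T)
    (i := φ.toRingHom.comp (adjoin k s).val.toRingHom) (c := c) (e := e)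
    (fun r => commute_map_of_mem_adjoin φ hc r.2) ⟨ht, by rw [innerDer_apply, hce, sub_self]⟩ he
    (map_mem_rightPolyLT φ.toRingHom hf) ?_))
  simpa using h0

/-- A subalgebra without zero divisors keeps this property after adjoining `t`, if `[c, t]` is a
unit of the subalgebra and `c` commutes with the subalgebra. -/
theorem mul_eq_zero_of_mem_adjoin_insert {s : Set T} {t : T}
    (hdom : ∀ x ∈ adjoin k s, ∀ y ∈ adjoin k s, x * y = 0 → x = 0 ∨ y = 0)
    (h : ∀ a ∈ s, NormalizesAt k s t a) (c e : T)
    (hc : ∀ a ∈ s, a * c = c * a) (ht : c * t - t * c = e) (hes : e ∈ adjoin k s)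
    (he : IsUnit e) :
    ∀ x ∈ adjoin k (insert t s), ∀ y ∈ adjoin k (insert t s), x * y = 0 → x = 0 ∨ y = 0 := by
  intro x hx y hy h0
  have : IsAddTorsionFree T := .of_algebra_field k
  by_contra! hne
  obtain ⟨n, hn⟩ := exists_mem_rightPolyLT h hx
  obtain ⟨n', hn'⟩ := exists_mem_rightPolyLT h hy
  obtain ⟨m, f, hf, r, hr, rfl⟩ := exists_eq_add_pow_mul hn hne.1
  obtain ⟨m', f', hf', r', hr', rfl⟩ := exists_eq_add_pow_mul hn' hne.2
  have hcomm : ∀ x ∈ adjoin k s, x * c = c * x :=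
    fun x hx => commute_map_of_mem_adjoin (AlgHom.id k T) hc hx
  have htop : HasTopDer c t 1 e := ⟨ht, innerDer_eq_zero (hcomm e hes)⟩
  -- The top derivative of the product is a positive integer times `(e ^ m * r) * (e ^ m' * r')`, a
  -- product inside the old subalgebra.
  have h1 := ((hasTopDer_add_pow_mul (fun r => hcomm _ r.2) htop hf r).mul
    (hasTopDer_add_pow_mul (fun r => hcomm _ r.2) htop hf' r')).1
  rw [h0, iterate_map_zero] at h1
  simp only [smul_mul_assoc, mul_smul_comm, smul_smul] at h1
  have h2 := (smul_eq_zero.1 h1.symm).resolve_left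
    (mul_ne_zero (Nat.choose_pos (by omega)).ne' (by positivity))
  rcases hdom _ (mul_mem (pow_mem hes _) r.2) _ (mul_mem (pow_mem hes _) r'.2) h2 with h3 | h3
  · exact hr ((he.pow m).mul_right_eq_zero.1 h3)
  · exact hr' ((he.pow m').mul_right_eq_zero.1 h3)

end AdjoinSteps

/-! ### Skew fields of fractions and their universal property. -/

section SkewFracLift

variable {k A W : Type*} [Field k] [Ring A] [Algebra k A] [IsNoetherianDomain A]
  [DivisionRing W] [Algebra k W]

/-- The canonical map from a noetherian domain to its skew field of fractions. -/
noncomputable def toSkewFrac (k A : Type*) [Field k] [Ring A] [Algebra k A]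
    [IsNoetherianDomain A] : A →ₐ[k] SkewFrac A where
  __ := OreLocalization.numeratorRingHom
  commutes' _ := rfl

theorem toSkewFrac_injective : Function.Injective (toSkewFrac k A) :=
  OreLocalization.numeratorHom_inj inf_le_left

theorem SkewFrac.exists_eq_inv_mul (x : SkewFrac A) :
    ∃ r s : A, x = (toSkewFrac k A s)⁻¹ * toSkewFrac k A r := by
  induction x using OreLocalization.ind with
  | _ r s =>
    refine ⟨r, s, ?_⟩
    have hs : toSkewFrac k A s ≠ 0 := by
      rw [Ne, map_eq_zero_iff _ toSkewFrac_injective]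
      exact nonZeroDivisors.ne_zero s.2
    rw [eq_inv_mul_iff_mul_eq₀ hs]
    exact OreLocalization.mul_cancel

theorem SkewFrac.subfield_eq_top {F : Subfield (SkewFrac A)} (h : ∀ a, toSkewFrac k A a ∈ F) :
    F = ⊤ := by
  rw [eq_top_iff]
  intro x _
  obtain ⟨r, s, rfl⟩ := SkewFrac.exists_eq_inv_mul (k := k) x
  exact mul_mem (inv_mem (h s)) (h r)

theorem SkewFrac.mem_subfield_of_mul {F : Subfield (SkewFrac A)} {a b : A} (h0 : a ≠ 0)
    (ha : toSkewFrac k A a ∈ F) (hab : toSkewFrac k A (a * b) ∈ F) : toSkewFrac k A b ∈ F := by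
  have h1 : toSkewFrac k A a ≠ 0 := by rwa [Ne, map_eq_zero_iff _ toSkewFrac_injective]
  have h2 : toSkewFrac k A b = (toSkewFrac k A a)⁻¹ * toSkewFrac k A (a * b) := by
    rw [eq_inv_mul_iff_mul_eq₀ h1, ← map_mul]
  exact h2 ▸ mul_mem (inv_mem ha) hab

/-- The extension of an injective algebra map to the skew field of fractions. -/
noncomputable def skewFracLift (φ : A →ₐ[k] W) (hφ : Function.Injective φ) :
    SkewFrac A →ₐ[k] W where
  __ := OreLocalization.universalHom φ.toRingHom
    (Units.liftRight (φ.toRingHom.toMonoidHom.comp (Submonoid.subtype _))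
      (fun s => Units.mk0 (φ s) ((map_ne_zero_iff φ hφ).2 (nonZeroDivisors.ne_zero s.2)))
      fun _ => rfl) fun _ => rfl
  commutes' r := (OreLocalization.universalHom_commutes _ _ _).trans (φ.commutes r)

theorem skewFracLift_toSkewFrac (φ : A →ₐ[k] W) (hφ : Function.Injective φ) (a : A) :
    skewFracLift φ hφ (toSkewFrac k A a) = φ a :=
  OreLocalization.universalHom_commutes _ _ _

/-- A skew field that contains `A` and is generated by `A` is the skew field of fractions
of `A`. -/
noncomputable def skewFracEquiv (φ : A →ₐ[k] W) (hφ : Function.Injective φ)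
    (htop : ∀ F : Subfield W, (∀ a, φ a ∈ F) → F = ⊤) : SkewFrac A ≃ₐ[k] W :=
  AlgEquiv.ofBijective (skewFracLift φ hφ) ⟨(skewFracLift φ hφ).toRingHom.injective, fun x => by
    have h := htop (skewFracLift φ hφ).toRingHom.fieldRange
      fun a => ⟨toSkewFrac k A a, skewFracLift_toSkewFrac φ hφ a⟩
    have hx : x ∈ (skewFracLift φ hφ).toRingHom.fieldRange := h ▸ Subfield.mem_top x
    exact hx⟩

end SkewFracLift

/-! ### Laurent polynomials in four variables and their Euler derivations. -/

section LaurentOperators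

variable (k : Type*) [Field k]

/-- Laurent polynomials in four variables. -/
abbrev Laurent4 : Type _ := AddMonoidAlgebra k (Fin 4 → ℤ)

/-- The operator that multiplies the monomial of exponent `m` by `m j`. -/
noncomputable def eulerOp (j : Fin 4) : Laurent4 k →ₗ[k] Laurent4 k :=
  (AddMonoidAlgebra.coeffLinearEquiv k).symm.toLinearMap ∘ₗ
    (Finsupp.lsum k fun m => (m j : k) • Finsupp.lsingle m) ∘ₗ
    (AddMonoidAlgebra.coeffLinearEquiv k).toLinearMap

variable {k}

theorem eulerOp_single (j : Fin 4) (m : Fin 4 → ℤ) (r : k) :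
    eulerOp k j (.single m r) = .single m (m j * r) := by
  simp [eulerOp, -Finsupp.single_mul]

variable (k)

/-- The Euler derivation of Laurent polynomials with respect to the variable `j`. -/
noncomputable def euler (j : Fin 4) : Derivation k (Laurent4 k) (Laurent4 k) :=
  .mk' (eulerOp k j) fun a b => by
    induction a using AddMonoidAlgebra.induction_linear with
    | zero => simp
    | add f g hf hg => simp only [add_mul, map_add, hf, hg, smul_eq_mul, mul_add]; abel
    | single m r =>
      induction b using AddMonoidAlgebra.induction_linear with
      | zero => simp
      | add f g hf hg => simp only [mul_add, map_add, hf, hg, smul_eq_mul, add_mul]; abel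
      | single n s =>
        simp only [AddMonoidAlgebra.single_mul_single, eulerOp_single, smul_eq_mul]
        rw [add_comm n m, ← AddMonoidAlgebra.single_add]
        congr 1
        push_cast [Pi.add_apply]
        ring

variable {k}

/-- The Laurent monomial of exponent `m`. -/
noncomputable def mon (k : Type*) [Field k] (m : Fin 4 → ℤ) : Laurent4 k := .single m 1

theorem mon_mul (m n : Fin 4 → ℤ) : mon k m * mon k n = mon k (m + n) := by
  simp [mon, AddMonoidAlgebra.single_mul_single]

theorem mon_zero : mon k 0 = 1 := rfl

theorem euler_mon (j : Fin 4) (m : Fin 4 → ℤ) :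
    euler k j (mon k m) = algebraMap k _ (m j) * mon k m := by
  change eulerOp k j (.single m 1) = _
  rw [eulerOp_single, ← Algebra.smul_def]
  simp [mon]

end LaurentOperators

/-! ### Calculus of differential operators of order at most one. -/

section DifferentialOperators

variable {k : Type*} [Field k]

/-- The variable `j` of the Laurent polynomial ring. -/
noncomputable def lvar (k : Type*) [Field k] (j : Fin 4) : Laurent4 k := mon k (Pi.single j 1)

/-- The inverse of the variable `j` of the Laurent polynomial ring. -/
noncomputable def lvarInv (k : Type*) [Field k] (j : Fin 4) : Laurent4 k :=
  mon k (Pi.single j (-1))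

theorem lvar_mul_lvarInv (j : Fin 4) : lvar k j * lvarInv k j = 1 := by
  rw [lvar, lvarInv, mon_mul, ← Pi.single_add, add_neg_cancel, Pi.single_zero, mon_zero]

theorem euler_lvar (i j : Fin 4) : euler k i (lvar k j) = if i = j then lvar k j else 0 := by
  rw [lvar, euler_mon, Pi.single_apply]
  split_ifs <;> simp only [Int.cast_one, Int.cast_zero, map_one, map_zero, one_mul, zero_mul]

theorem euler_lvarInv (i j : Fin 4) :
    euler k i (lvarInv k j) = if i = j then -lvarInv k j else 0 := by
  rw [lvarInv, euler_mon, Pi.single_apply]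
  split_ifs <;> simp only [Int.cast_one, Int.cast_neg, Int.cast_zero, map_one, map_neg, map_zero,
    one_mul, neg_mul, zero_mul]

/-- Multiplication operators on Laurent polynomials. -/
noncomputable def mulOp (k : Type*) [Field k] : Laurent4 k →ₐ[k] Module.End k (Laurent4 k) :=
  Algebra.lmul k (Laurent4 k)

theorem mulOp_apply (f g : Laurent4 k) : mulOp k f g = f * g := rfl

theorem mulOp_injective : Function.Injective (mulOp k) := Algebra.lmul_injective

/-- The Euler derivations as operators. -/
noncomputable def eulerEnd (k : Type*) [Field k] (j : Fin 4) : Module.End k (Laurent4 k) :=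
  (euler k j : Laurent4 k →ₗ[k] Laurent4 k)

theorem eulerEnd_mul_mulOp (j : Fin 4) (f : Laurent4 k) :
    eulerEnd k j * mulOp k f = mulOp k f * eulerEnd k j + mulOp k (euler k j f) := by
  refine LinearMap.ext fun x => ?_
  simp [eulerEnd, mulOp_apply, mul_comm x]

/-- Both operators are diagonal on monomials. -/
theorem eulerEnd_commute (i j : Fin 4) :
    eulerEnd k i * eulerEnd k j = eulerEnd k j * eulerEnd k i := by
  have h : ∀ (i j : Fin 4) (m : Fin 4 → ℤ) (r : k), (eulerEnd k i * eulerEnd k j) (.single m r) =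
      .single m (m i * (m j * r)) := fun i j m r => by
    change eulerOp k i (eulerOp k j (.single m r)) = _
    rw [eulerOp_single, eulerOp_single]
  refine LinearMap.ext fun x => ?_
  induction x using AddMonoidAlgebra.induction_linear with
  | zero => simp
  | add f g hf hg => rw [map_add, map_add, hf, hg]
  | single m r => rw [h, h, mul_left_comm]

/-- Differential operators of order at most one in the first two variables. -/
noncomputable def diffOp (a b c : Laurent4 k) : Module.End k (Laurent4 k) :=
  mulOp k a + mulOp k b * eulerEnd k 0 + mulOp k c * eulerEnd k 1

theorem diffOp_zero_zero (a : Laurent4 k) : diffOp a 0 0 = mulOp k a := by simp [diffOp]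

theorem diffOp_one : diffOp (1 : Laurent4 k) 0 0 = 1 := by simp [diffOp]

theorem diffOp_add (a b c a' b' c' : Laurent4 k) :
    diffOp a b c + diffOp a' b' c' = diffOp (a + a') (b + b') (c + c') := by
  simp only [diffOp, map_add, add_mul]
  abel

theorem diffOp_sub (a b c a' b' c' : Laurent4 k) :
    diffOp a b c - diffOp a' b' c' = diffOp (a - a') (b - b') (c - c') := by
  simp only [diffOp, map_sub, sub_mul]
  abel

theorem diffOp_smul (r : k) (a b c : Laurent4 k) :
    r • diffOp a b c = diffOp (algebraMap k _ r * a) (algebraMap k _ r * b)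
      (algebraMap k _ r * c) := by
  simp only [diffOp, ← Algebra.smul_def, map_smul, smul_add, smul_mul_assoc]

theorem mul_diffOp (f a b c : Laurent4 k) :
    diffOp f 0 0 * diffOp a b c = diffOp (f * a) (f * b) (f * c) := by
  simp only [diffOp, map_mul, map_zero, zero_mul, add_zero, mul_add, mul_assoc]

theorem diffOp_mul (f a b c : Laurent4 k) :
    diffOp a b c * diffOp f 0 0 =
      diffOp (f * a + b * euler k 0 f + c * euler k 1 f) (f * b) (f * c) := by
  simp only [diffOp, map_zero, zero_mul, add_zero, add_mul, mul_assoc, eulerEnd_mul_mulOp, mul_add,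
    map_mul, map_add]
  simp only [← mul_assoc, ← map_mul, mul_comm f]
  abel

/-- The second-order part of a product is symmetric in the two factors, so the commutator has order
at most one. -/
theorem diffOp_mul_comm (a b c p q r : Laurent4 k) :
    diffOp a b c * diffOp p q r = diffOp p q r * diffOp a b c + diffOp
      (b * euler k 0 p + c * euler k 1 p - q * euler k 0 a - r * euler k 1 a)
      (b * euler k 0 q + c * euler k 1 q - q * euler k 0 b - r * euler k 1 b)
      (b * euler k 0 r + c * euler k 1 r - q * euler k 0 c - r * euler k 1 c) := by
  -- All summands after the first `diffOp` are invariant under exchanging `(a, b, c)` with `(p, q,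
  -- r)`.
  have key : ∀ a b c p q r : Laurent4 k, diffOp a b c * diffOp p q r =
      diffOp (b * euler k 0 p + c * euler k 1 p) (b * euler k 0 q + c * euler k 1 q)
        (b * euler k 0 r + c * euler k 1 r) +
      (mulOp k (a * p) + mulOp k (a * q + b * p) * eulerEnd k 0 +
        mulOp k (a * r + c * p) * eulerEnd k 1 + mulOp k (b * q) * (eulerEnd k 0 * eulerEnd k 0) +
        mulOp k (b * r + c * q) * (eulerEnd k 0 * eulerEnd k 1) +
        mulOp k (c * r) * (eulerEnd k 1 * eulerEnd k 1)) := by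
    intro a b c p q r
    have h : ∀ (j : Fin 4) (f g : Laurent4 k) (y : Module.End k (Laurent4 k)),
        mulOp k f * eulerEnd k j * (mulOp k g * y) =
          mulOp k (f * g) * (eulerEnd k j * y) + mulOp k (f * euler k j g) * y := by
      intro j f g y
      rw [mul_assoc, ← mul_assoc (eulerEnd k j), eulerEnd_mul_mulOp, map_mul, map_mul]
      simp only [add_mul, mul_add, mul_assoc]
    have h0 := fun (j : Fin 4) (f g : Laurent4 k) => h j f g 1
    simp only [mul_one] at h0
    simp only [diffOp, add_mul, mul_add, h, h0, map_add, eulerEnd_commute 1 0]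
    simp only [map_mul, mul_assoc]
    abel
  rw [key, key p q r, mul_comm p a, mul_comm q b, mul_comm r c, add_comm (p * b), add_comm (p * c),
    add_comm (q * c), mul_comm q a, mul_comm r a, mul_comm p b, mul_comm p c, mul_comm q c,
    mul_comm r b]
  rw [add_right_comm (diffOp _ _ _), diffOp_add]
  congr 2 <;> ring

end DifferentialOperators

/-! ### The operators representing `𝒟` and the verification of its relations. -/

section JordanOperators

variable {k : Type*} [Field k]

/-- The constant `1 / 2`. -/
noncomputable def half (k : Type*) [Field k] : Laurent4 k := algebraMap k _ (1 / 2)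

theorem two_mul_half [CharZero k] : (2 : Laurent4 k) * half k = 1 := by
  rw [half, ← map_ofNat (algebraMap k (Laurent4 k)) 2, ← map_mul]
  rw [mul_one_div_cancel two_ne_zero, map_one]

theorem euler_half (j : Fin 4) : euler k j (half k) = 0 := (euler k j).map_algebraMap _

theorem half_smul_diffOp (a b c : Laurent4 k) :
    (1 / 2 : k) • diffOp a b c = diffOp (half k * a) (half k * b) (half k * c) :=
  diffOp_smul _ _ _ _

theorem diffOp_congr {a b c a' b' c' : Laurent4 k} (ha : a = a') (hb : b = b') (hc : c = c') :
    diffOp a b c = diffOp a' b' c' := by rw [ha, hb, hc]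

/-- The image of `g`. -/
noncomputable def jordanG (k : Type*) [Field k] : Laurent4 k := lvar k 1 ^ 2 * lvar k 2

/-- The image of `x * u`. -/
noncomputable def jordanW (k : Type*) [Field k] : Laurent4 k := lvar k 1 - 2 - 2 * jordanG k

theorem euler_two (j : Fin 4) : euler k j 2 = 0 := by
  exact_mod_cast (euler k j).map_natCast 2

theorem euler_three (j : Fin 4) : euler k j 3 = 0 := by
  exact_mod_cast (euler k j).map_natCast 3

theorem diffOp_neg (a b c : Laurent4 k) : -diffOp a b c = diffOp (-a) (-b) (-c) := by
  rw [← zero_sub, ← zero_sub a, ← zero_sub b, ← zero_sub c, ← diffOp_sub]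
  simp [diffOp]

theorem euler_jordanG_zero : euler k 0 (jordanG k) = 0 := by
  simp [jordanG, euler_lvar, pow_two]

theorem euler_jordanG_one : euler k 1 (jordanG k) = 2 * jordanG k := by
  simp only [jordanG, pow_two, Derivation.leibniz, euler_lvar, smul_eq_mul]
  simp
  ring

theorem euler_jordanW_zero : euler k 0 (jordanW k) = 0 := by
  simp [jordanW, euler_lvar, euler_two, euler_jordanG_zero]

theorem euler_jordanW_one : euler k 1 (jordanW k) = lvar k 1 - 4 * jordanG k := by
  simp only [jordanW, map_sub, Derivation.leibniz, euler_lvar, smul_eq_mul, euler_two,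
    euler_jordanG_one]
  simp
  ring

/-- The differential operators that represent the generators of the double of the Jordan plane. -/
noncomputable def jordanOp (k : Type*) [Field k] : JordanGen → Module.End k (Laurent4 k)
  | .u => diffOp (lvarInv k 0 * jordanW k) 0 0
  | .v => diffOp (lvarInv k 0 * (lvar k 1 * lvar k 3 + 2 + 2 * jordanG k))
      (lvarInv k 0 * (lvar k 1 - 1 - 3 * jordanG k))
      (half k * (lvarInv k 0 * jordanW k))
  | .zeta => diffOp 0 1 0
  | .g => diffOp (jordanG k) 0 0
  | .gInv => diffOp (lvarInv k 1 ^ 2 * lvarInv k 2) 0 0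
  | .x => diffOp (lvar k 0) 0 0
  | .y => diffOp 0 (-half k * lvar k 0) (-half k * lvar k 0)

theorem jordanG_mul_inv : jordanG k * (lvarInv k 1 ^ 2 * lvarInv k 2) = 1 := by
  have h1 := lvar_mul_lvarInv (k := k) 1
  have h2 := lvar_mul_lvarInv (k := k) 2
  rw [jordanG]
  linear_combination (lvar k 1 * lvarInv k 1 + 1) * lvar k 2 * lvarInv k 2 * h1 + h2

/-- Comparing coefficients turns each relation into identities of Laurent polynomials. Only
`zeta_y`, `v_zeta` and `v_y` multiply two operators of positive order and need `diffOp_mul_comm`;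
elsewhere one factor of each product is a multiplication operator. -/
theorem jordanOp_rel [CharZero k] {a b : FreeAlgebra k JordanGen} (h : JordanDoubleRel k a b) :
    FreeAlgebra.lift k (jordanOp k) a = FreeAlgebra.lift k (jordanOp k) b := by
  have h0 := lvar_mul_lvarInv (k := k) 0
  have hh := two_mul_half (k := k)
  have hG := jordanG_mul_inv (k := k)
  have hW : lvar k 1 = jordanW k + 2 + 2 * jordanG k := by rw [jordanW]; ring
  cases h <;> simp only [map_mul, map_add, map_sub, map_smul, map_pow, map_one,
    JordanGen.X, FreeAlgebra.lift_ι_apply, jordanOp]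
  case g_gInv => rw [mul_diffOp, mul_zero, hG, diffOp_one]
  case gInv_g => rw [mul_diffOp, mul_zero, mul_comm, hG, diffOp_one]
  case zeta_y =>
    rw [diffOp_mul_comm, add_right_inj]
    apply diffOp_congr <;> simp [euler_lvar, euler_half]
  case v_zeta =>
    rw [diffOp_mul_comm, add_right_inj]
    apply diffOp_congr <;> simp only [map_add, map_sub, Derivation.leibniz, smul_eq_mul, euler_lvar,
      euler_lvarInv, euler_jordanG_zero, euler_jordanW_zero, euler_two, euler_three, euler_half,
      Derivation.map_one_eq_zero, map_zero] <;> simp [-mul_eq_mul_left_iff] <;> ring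
  case v_y =>
    have key (a b c : Module.End k (Laurent4 k)) : a - b + c = a + (c - b) := by abel
    rw [diffOp_mul_comm, key, add_right_inj, mul_diffOp, diffOp_mul, diffOp_sub]
    apply diffOp_congr <;> simp [euler_lvar, euler_lvarInv, euler_jordanG_zero, euler_jordanG_one,
      euler_jordanW_zero, euler_jordanW_one, euler_two, euler_three, euler_half]
    case ha => linear_combination half k * lvar k 0 * lvarInv k 0 * hW
    case hb =>
      linear_combination -(half k * lvar k 0 * lvarInv k 0) * hW - 2 * jordanG k * half k * h0 -
        jordanG k * hh
    case hc =>
      linear_combination half k * lvar k 0 * lvarInv k 0 * (1 - jordanG k) * hh +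
        half k * lvar k 0 * lvarInv k 0 * (half k - 1) * hW
  all_goals
    simp only [pow_two, mul_diffOp, diffOp_mul, half_smul_diffOp, diffOp_sub, diffOp_add,
      ← diffOp_one]
    apply diffOp_congr
  all_goals simp [euler_lvar, euler_lvarInv, euler_jordanG_zero, euler_jordanG_one,
    euler_jordanW_zero, euler_jordanW_one]
  case g_y.ha => linear_combination lvar k 0 * jordanG k * hh
  case v_g.ha => linear_combination lvarInv k 0 * jordanW k * jordanG k * hh
  case v_u.ha =>
    linear_combination lvarInv k 0 ^ 2 * jordanW k * (jordanW k + 1 - jordanG k) * hh +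
      lvarInv k 0 ^ 2 * jordanW k * (half k - 1) * hW
  case v_x.ha => linear_combination (1 - jordanG k) * h0 + lvar k 0 * lvarInv k 0 * hW
  case u_y.ha =>
    linear_combination (1 - jordanG k) * 2 * half k * h0 + (1 - jordanG k) * hh +
      half k * lvar k 0 * lvarInv k 0 * hW
  all_goals ring

end JordanOperators

/-! ### The algebra of Laurent differential operators is a noetherian domain. -/

section OperatorAlgebra

open Algebra

theorem IsNormalizingChain.isNoetherianDomain_adjoin {k A : Type*} [Field k] [Ring A] [Algebra k A]
    [Nontrivial A] {s : Set A} (hs : IsNormalizingChain k s)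
    (hdom : ∀ x ∈ adjoin k s, ∀ y ∈ adjoin k s, x * y = 0 → x = 0 ∨ y = 0) :
    IsNoetherianDomain (adjoin k s) where
  isDomain :=
    have : NoZeroDivisors (adjoin k s) := ⟨fun {a b} h => by
      simpa using hdom a a.2 b b.2 (congrArg Subtype.val h)⟩
    NoZeroDivisors.to_isDomain _
  left_noetherian := hs.isNoetherianRing_adjoin
  right_noetherian := by
    have h := hs.op.isNoetherianRing_adjoin
    rw [← Subalgebra.op_adjoin] at h
    let f : (adjoin k s).op →+* (adjoin k s)ᵐᵒᵖ :=
      { toFun := fun x => .op ⟨x.1.unop, x.2⟩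
        map_one' := rfl
        map_mul' := fun _ _ => rfl
        map_zero' := rfl
        map_add' := fun _ _ => rfl }
    exact isNoetherianRing_of_surjective _ _ f fun x => ⟨⟨.op x.unop.1, x.unop.2⟩, rfl⟩

variable (k : Type*) [Field k]

/-- Generators of the multiplication operators. -/
def mulOpGens : Set (Module.End k (Laurent4 k)) :=
  mulOp k '' (Set.range (lvar k) ∪ Set.range (lvarInv k))

/-- The algebra of differential operators generated by multiplication operators and the first two
Euler derivations. -/
noncomputable def laurentDiffOps : Subalgebra k (Module.End k (Laurent4 k)) :=
  adjoin k (insert (eulerEnd k 1) (insert (eulerEnd k 0) (mulOpGens k)))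

variable {k}

theorem isNormalizingChain_mulOp_image {F : Set (Laurent4 k)} (hF : F.Finite) :
    IsNormalizingChain k (mulOp k '' F) := by
  induction F, hF using Set.Finite.induction_on with
  | empty => simpa using IsNormalizingChain.empty
  | @insert f F _ _ ih =>
    rw [Set.image_insert_eq]
    refine ih.cons fun a ha => .of_commute (subset_adjoin ha) ?_
    obtain ⟨h, -, rfl⟩ := ha
    rw [← map_mul, mul_comm, map_mul]

theorem normalizesAt_eulerEnd (j : Fin 4) : ∀ a ∈ mulOpGens k,
    NormalizesAt k (mulOpGens k) (eulerEnd k j) a := by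
  rintro _ ⟨f, hf, rfl⟩
  have hmem : mulOp k f ∈ adjoin k (mulOpGens k) := subset_adjoin ⟨f, hf, rfl⟩
  refine .of_commutator hmem ?_
  rw [eulerEnd_mul_mulOp, add_sub_cancel_left]
  rcases hf with ⟨i, rfl⟩ | ⟨i, rfl⟩
  · rw [euler_lvar]
    split_ifs
    · exact hmem
    · simp
  · rw [euler_lvarInv]
    split_ifs
    · rw [map_neg]
      exact neg_mem hmem
    · simp

theorem normalizesAt_eulerEnd_one : ∀ a ∈ insert (eulerEnd k 0) (mulOpGens k),
    NormalizesAt k (insert (eulerEnd k 0) (mulOpGens k)) (eulerEnd k 1) a := by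
  rintro a (rfl | ha)
  · exact .of_commute (subset_adjoin (Set.mem_insert _ _)) (eulerEnd_commute _ _)
  · have hle := adjoin_mono (R := k) (Set.subset_insert (eulerEnd k 0) (mulOpGens k))
    obtain ⟨⟨b, hb, c, hc, e⟩, ⟨b', hb', c', hc', e'⟩⟩ := normalizesAt_eulerEnd 1 a ha
    exact ⟨⟨b, hle hb, c, hle hc, e⟩, ⟨b', hle hb', c', hle hc', e'⟩⟩

theorem isNormalizingChain_laurentDiffOps : IsNormalizingChain k
    (insert (eulerEnd k 1) (insert (eulerEnd k 0) (mulOpGens k))) :=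
  ((isNormalizingChain_mulOp_image
    ((Set.finite_range _).union (Set.finite_range _))).cons (normalizesAt_eulerEnd 0)).cons
    normalizesAt_eulerEnd_one

theorem isUnit_mulOp {f g : Laurent4 k} (h : f * g = 1) : IsUnit (mulOp k f) :=
  (IsUnit.of_mul_eq_one g h).map (mulOp k)

theorem isUnit_mulOp_lvar (j : Fin 4) : IsUnit (mulOp k (lvar k j)) :=
  isUnit_mulOp (lvar_mul_lvarInv j)

theorem mulOp_commute (f g : Laurent4 k) : mulOp k f * mulOp k g = mulOp k g * mulOp k f := by
  rw [← map_mul, mul_comm, map_mul]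

theorem mulOp_lvar_mem (j : Fin 4) : mulOp k (lvar k j) ∈ mulOpGens k :=
  ⟨_, .inl ⟨j, rfl⟩, rfl⟩

/-- Multiplication operators form a domain. Adjoining `E₀` and then `E₁` keeps this, with `c = Xⱼ`
and the unit `[Xⱼ, Eⱼ] = -Xⱼ`. -/
instance laurentDiffOps_isNoetherianDomain [CharZero k] :
    IsNoetherianDomain (laurentDiffOps k) := by
  refine isNormalizingChain_laurentDiffOps.isNoetherianDomain_adjoin ?_
  refine mul_eq_zero_of_mem_adjoin_insert (mul_eq_zero_of_mem_adjoin_insert ?_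
    (normalizesAt_eulerEnd 0) (mulOp k (lvar k 0)) (-mulOp k (lvar k 0)) ?_ ?_ ?_ ?_)
    normalizesAt_eulerEnd_one (mulOp k (lvar k 1)) (-mulOp k (lvar k 1)) ?_ ?_ ?_ ?_
  · have hle : adjoin k (mulOpGens k) ≤ (mulOp k).range :=
      adjoin_le fun x ⟨f, _, hf⟩ => ⟨f, hf⟩
    intro x hx y hy h
    obtain ⟨f, rfl⟩ := hle hx
    obtain ⟨g, rfl⟩ := hle hy
    change mulOp k f * mulOp k g = 0 at h
    change mulOp k f = 0 ∨ mulOp k g = 0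
    rw [← map_mul, map_eq_zero_iff _ mulOp_injective] at h
    simpa [map_eq_zero_iff _ mulOp_injective] using h
  · rintro _ ⟨f, -, rfl⟩
    exact mulOp_commute _ _
  · rw [eulerEnd_mul_mulOp, euler_lvar]
    simp
  · exact neg_mem (subset_adjoin (mulOp_lvar_mem 0))
  · exact (isUnit_mulOp_lvar (k := k) 0).neg
  · rintro a (rfl | ⟨f, -, rfl⟩)
    · rw [eulerEnd_mul_mulOp, euler_lvar]
      simp
    · exact mulOp_commute _ _
  · rw [eulerEnd_mul_mulOp, euler_lvar]
    simp
  · exact neg_mem (subset_adjoin (.inr (mulOp_lvar_mem 1)))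
  · exact (isUnit_mulOp_lvar (k := k) 1).neg

theorem mulOp_mem_laurentDiffOps {f : Laurent4 k}
    (h : f ∈ adjoin k (Set.range (lvar k) ∪ Set.range (lvarInv k))) :
    mulOp k f ∈ laurentDiffOps k := by
  have h1 : mulOp k f ∈ adjoin k (mulOpGens k) := by
    rw [mulOpGens, ← AlgHom.map_adjoin]
    exact ⟨f, h, rfl⟩
  exact adjoin_mono ((Set.subset_insert _ _).trans (Set.subset_insert _ _)) h1

theorem eulerEnd_zero_mem : eulerEnd k 0 ∈ laurentDiffOps k := subset_adjoin (.inr (.inl rfl))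

theorem eulerEnd_one_mem : eulerEnd k 1 ∈ laurentDiffOps k := subset_adjoin (.inl rfl)

end OperatorAlgebra

/-! ### The generators of `𝒟` form a normalizing chain. -/

section JordanDouble

open Algebra

variable {k : Type*} [Field k]

/-- The generators of the double of the Jordan plane. -/
noncomputable def jgen (k : Type*) [Field k] (a : JordanGen) : JordanDouble k :=
  RingQuot.mkAlgHom k (JordanDoubleRel k) (FreeAlgebra.ι k a)

theorem jordan_relation {a b : FreeAlgebra k JordanGen} (h : JordanDoubleRel k a b) :
    FreeAlgebra.lift k (jgen k) a = FreeAlgebra.lift k (jgen k) b := by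
  have : FreeAlgebra.lift k (jgen k) = RingQuot.mkAlgHom k (JordanDoubleRel k) := by
    ext a
    simp [jgen]
  rw [this]
  exact RingQuot.mkAlgHom_rel k h

theorem adjoin_range_jgen : adjoin k (Set.range (jgen k)) = ⊤ := by
  have h : Set.range (jgen k) =
      RingQuot.mkAlgHom k (JordanDoubleRel k) '' Set.range (FreeAlgebra.ι k) := by
    rw [← Set.range_comp]
    rfl
  rw [h, ← AlgHom.map_adjoin, FreeAlgebra.adjoin_range_ι, Algebra.map_top, AlgHom.range_eq_top]
  exact RingQuot.mkAlgHom_surjective k _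

open JordanGen

theorem jgen_g_mul_gInv : jgen k g * jgen k gInv = 1 := by
  simpa using jordan_relation (k := k) .g_gInv

theorem jgen_gInv_mul_g : jgen k gInv * jgen k g = 1 := by
  simpa using jordan_relation (k := k) .gInv_g

/-- The commutator of `a` with `g⁻¹`. -/
theorem commutator_gInv (a : JordanDouble k) :
    a * jgen k gInv - jgen k gInv * a =
      -(jgen k gInv * (a * jgen k g - jgen k g * a) * jgen k gInv) := by
  rw [mul_sub, sub_mul, ← mul_assoc, ← mul_assoc, jgen_gInv_mul_g, one_mul,
    mul_assoc _ _ (jgen k gInv), jgen_g_mul_gInv, mul_one, neg_sub]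

/-- The chain is read from the right. The commutator of a generator with an earlier one lies in the
algebra of the earlier ones, except for the pairs `ζ, y` and `ζ, v`, where it is a multiple of the
new generator. -/
theorem jgen_chain_eq : Set.range (jgen k) =
    {jgen k v, jgen k y, jgen k zeta, jgen k u, jgen k x, jgen k gInv, jgen k g} := by
  ext a
  constructor
  · rintro ⟨b, rfl⟩
    cases b <;> simp
  · simp only [Set.mem_insert_iff, Set.mem_singleton_iff]
    rintro (rfl | rfl | rfl | rfl | rfl | rfl | rfl) <;> exact ⟨_, rfl⟩

theorem normalizesAt_gInv : ∀ a ∈ ({jgen k g} : Set (JordanDouble k)),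
    NormalizesAt k {jgen k g} (jgen k gInv) a := by
  rintro _ rfl
  exact .of_commute (subset_adjoin rfl) (by rw [jgen_g_mul_gInv, jgen_gInv_mul_g])

/-- Since `[t, g⁻¹] = -g⁻¹[t, g]g⁻¹`, the commutator with `g` decides. -/
theorem NormalizesAt.of_commutator_gInv {s : Set (JordanDouble k)} {t : JordanDouble k}
    (hg : jgen k gInv ∈ s) (h : t * jgen k g - jgen k g * t ∈ adjoin k s) :
    NormalizesAt k s t (jgen k gInv) :=
  .of_commutator (subset_adjoin hg) (by
    rw [commutator_gInv]
    exact neg_mem (mul_mem (mul_mem (subset_adjoin hg) h) (subset_adjoin hg)))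

theorem normalizesAt_x : ∀ a ∈ ({jgen k gInv, jgen k g} : Set (JordanDouble k)),
    NormalizesAt k {jgen k gInv, jgen k g} (jgen k x) a := by
  have h : jgen k x * jgen k g - jgen k g * jgen k x = 0 := by
    simpa [sub_eq_zero, eq_comm] using jordan_relation (k := k) .g_x
  simp only [Set.mem_insert_iff, Set.mem_singleton_iff, forall_eq_or_imp, forall_eq]
  refine ⟨.of_commutator_gInv (by simp) (h ▸ zero_mem _),
    .of_commutator (subset_adjoin (by simp)) (h ▸ zero_mem _)⟩

theorem normalizesAt_u : ∀ a ∈ ({jgen k x, jgen k gInv, jgen k g} : Set (JordanDouble k)),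
    NormalizesAt k {jgen k x, jgen k gInv, jgen k g} (jgen k u) a := by
  have h : jgen k u * jgen k g - jgen k g * jgen k u = 0 := by
    simpa [sub_eq_zero] using jordan_relation (k := k) .u_g
  have hx : jgen k u * jgen k x = jgen k x * jgen k u := by
    simpa using jordan_relation (k := k) .u_x
  simp only [Set.mem_insert_iff, Set.mem_singleton_iff, forall_eq_or_imp, forall_eq]
  exact ⟨.of_commute (subset_adjoin (by simp)) hx, .of_commutator_gInv (by simp) (h ▸ zero_mem _),
    .of_commutator (subset_adjoin (by simp)) (h ▸ zero_mem _)⟩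

theorem normalizesAt_zeta :
    ∀ a ∈ ({jgen k u, jgen k x, jgen k gInv, jgen k g} : Set (JordanDouble k)),
      NormalizesAt k {jgen k u, jgen k x, jgen k gInv, jgen k g} (jgen k zeta) a := by
  set s : Set (JordanDouble k) := {jgen k u, jgen k x, jgen k gInv, jgen k g} with hs
  have hmem {a} (ha : a ∈ s) : a ∈ adjoin k s := subset_adjoin ha
  have hg : jgen k zeta * jgen k g - jgen k g * jgen k zeta = 0 := by
    simpa [sub_eq_zero] using jordan_relation (k := k) .zeta_g
  have hx : jgen k zeta * jgen k x - jgen k x * jgen k zeta = jgen k x := by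
    rw [sub_eq_iff_eq_add']
    simpa using jordan_relation (k := k) .zeta_x
  have hu : jgen k zeta * jgen k u - jgen k u * jgen k zeta = -jgen k u := by
    have := jordan_relation (k := k) .u_zeta
    simp only [map_mul, map_add, X, FreeAlgebra.lift_ι_apply] at this
    rw [this]
    abel
  have hu' : jgen k u ∈ s := by simp [hs]
  have hx' : jgen k x ∈ s := by simp [hs]
  have hgi' : jgen k gInv ∈ s := by simp [hs]
  have hg' : jgen k g ∈ s := by simp [hs]
  simp only [hs, Set.mem_insert_iff, Set.mem_singleton_iff, forall_eq_or_imp, forall_eq]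
  rw [← hs]
  refine ⟨.of_commutator (hmem hu') ?_, .of_commutator (hmem hx') ?_, .of_commutator_gInv hgi' ?_,
    .of_commutator (hmem hg') ?_⟩
  · exact hu ▸ neg_mem (hmem hu')
  · rw [hx]
    exact hmem hx'
  · exact hg ▸ zero_mem _
  · exact hg ▸ zero_mem _

theorem normalizesAt_y :
    ∀ a ∈ ({jgen k zeta, jgen k u, jgen k x, jgen k gInv, jgen k g} : Set (JordanDouble k)),
      NormalizesAt k {jgen k zeta, jgen k u, jgen k x, jgen k gInv, jgen k g} (jgen k y) a := by
  set s : Set (JordanDouble k) := {jgen k zeta, jgen k u, jgen k x, jgen k gInv, jgen k g} with hs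
  have hmem {a} (ha : a ∈ s) : a ∈ adjoin k s := subset_adjoin ha
  have hg : jgen k y * jgen k g - jgen k g * jgen k y = -(jgen k x * jgen k g) := by
    have := jordan_relation (k := k) .g_y
    simp only [map_mul, map_add, X, FreeAlgebra.lift_ι_apply] at this
    rw [this]
    abel
  have hx : jgen k y * jgen k x - jgen k x * jgen k y = -((1 / 2 : k) • jgen k x ^ 2) := by
    have := jordan_relation (k := k) .y_x
    simp only [map_mul, map_sub, map_smul, map_pow, X, FreeAlgebra.lift_ι_apply] at this
    rw [this]
    abel
  have hu : jgen k y * jgen k u - jgen k u * jgen k y = -(1 - jgen k g) := by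
    have := jordan_relation (k := k) .u_y
    simp only [map_mul, map_add, map_sub, map_one, X, FreeAlgebra.lift_ι_apply] at this
    rw [this]
    abel
  have hz : jgen k zeta * jgen k y = jgen k y * jgen k zeta + jgen k y := by
    simpa using jordan_relation (k := k) .zeta_y
  have hz' : jgen k zeta ∈ s := by simp [hs]
  have hu' : jgen k u ∈ s := by simp [hs]
  have hx' : jgen k x ∈ s := by simp [hs]
  have hgi' : jgen k gInv ∈ s := by simp [hs]
  have hg' : jgen k g ∈ s := by simp [hs]
  have hgmem : jgen k y * jgen k g - jgen k g * jgen k y ∈ adjoin k s :=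
    hg ▸ neg_mem (mul_mem (hmem hx') (hmem hg'))
  simp only [hs, Set.mem_insert_iff, Set.mem_singleton_iff, forall_eq_or_imp, forall_eq]
  rw [← hs]
  refine ⟨.of_mul_eq_add (hmem hz') hz, .of_commutator (hmem hu') ?_,
    .of_commutator (hmem hx') ?_, .of_commutator_gInv hgi' hgmem, .of_commutator (hmem hg') hgmem⟩
  · exact hu ▸ neg_mem (sub_mem (one_mem _) (hmem hg'))
  · exact hx ▸ neg_mem (Subalgebra.smul_mem _ (pow_mem (hmem hx') 2) _)

theorem normalizesAt_v :
    ∀ a ∈ ({jgen k y, jgen k zeta, jgen k u, jgen k x, jgen k gInv, jgen k g} :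
      Set (JordanDouble k)),
      NormalizesAt k {jgen k y, jgen k zeta, jgen k u, jgen k x, jgen k gInv, jgen k g}
        (jgen k v) a := by
  set s : Set (JordanDouble k) :=
    {jgen k y, jgen k zeta, jgen k u, jgen k x, jgen k gInv, jgen k g} with hs
  have hmem {a} (ha : a ∈ s) : a ∈ adjoin k s := subset_adjoin ha
  have hg : jgen k v * jgen k g - jgen k g * jgen k v = jgen k g * jgen k u := by
    have := jordan_relation (k := k) .v_g
    simp only [map_mul, map_add, X, FreeAlgebra.lift_ι_apply] at this
    rw [this]
    abel
  have hx : jgen k v * jgen k x - jgen k x * jgen k v =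
      1 - jgen k g + jgen k x * jgen k u := by
    have := jordan_relation (k := k) .v_x
    simp only [map_mul, map_add, map_sub, map_one, X, FreeAlgebra.lift_ι_apply] at this
    rw [this]
    abel
  have hu : jgen k v * jgen k u - jgen k u * jgen k v = -((1 / 2 : k) • jgen k u ^ 2) := by
    have := jordan_relation (k := k) .v_u
    simp only [map_mul, map_sub, map_smul, map_pow, X, FreeAlgebra.lift_ι_apply] at this
    rw [this]
    abel
  have hy : jgen k v * jgen k y - jgen k y * jgen k v =
      jgen k y * jgen k u - jgen k g * jgen k zeta := by
    have := jordan_relation (k := k) .v_y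
    simp only [map_mul, map_add, map_sub, X, FreeAlgebra.lift_ι_apply] at this
    rw [this]
    abel
  have hz : jgen k v * jgen k zeta = (jgen k zeta + algebraMap k _ 1) * jgen k v := by
    have := jordan_relation (k := k) .v_zeta
    simp only [map_mul, map_add, X, FreeAlgebra.lift_ι_apply] at this
    simp [add_mul, this]
  have hy' : jgen k y ∈ s := by simp [hs]
  have hz' : jgen k zeta ∈ s := by simp [hs]
  have hu' : jgen k u ∈ s := by simp [hs]
  have hx' : jgen k x ∈ s := by simp [hs]
  have hgi' : jgen k gInv ∈ s := by simp [hs]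
  have hg' : jgen k g ∈ s := by simp [hs]
  have hgmem : jgen k v * jgen k g - jgen k g * jgen k v ∈ adjoin k s :=
    hg ▸ mul_mem (hmem hg') (hmem hu')
  simp only [hs, Set.mem_insert_iff, Set.mem_singleton_iff, forall_eq_or_imp, forall_eq]
  rw [← hs]
  refine ⟨.of_commutator (hmem hy') ?_, .of_eq_add_mul (hmem hz') _ hz,
    .of_commutator (hmem hu') ?_, .of_commutator (hmem hx') ?_, .of_commutator_gInv hgi' hgmem,
    .of_commutator (hmem hg') hgmem⟩
  · exact hy ▸ sub_mem (mul_mem (hmem hy') (hmem hu')) (mul_mem (hmem hg') (hmem hz'))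
  · exact hu ▸ neg_mem (Subalgebra.smul_mem _ (pow_mem (hmem hu') 2) _)
  · exact hx ▸ add_mem (sub_mem (one_mem _) (hmem hg')) (mul_mem (hmem hx') (hmem hu'))

theorem isNormalizingChain_jgen : IsNormalizingChain k (Set.range (jgen k)) := by
  rw [jgen_chain_eq]
  have h : IsNormalizingChain k ({jgen k g} : Set (JordanDouble k)) := by
    simpa using IsNormalizingChain.empty.cons (k := k) (t := jgen k g) (by simp)
  exact (((((h.cons normalizesAt_gInv).cons normalizesAt_x).cons normalizesAt_u).cons
    normalizesAt_zeta).cons normalizesAt_y).cons normalizesAt_v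

end JordanDouble

/-! ### Faithfulness of the representation. -/

section JordanRep

open Algebra JordanGen

variable {k : Type*} [Field k]

/-- A derivation of Laurent polynomials as an operator. -/
noncomputable def derEnd (δ : Derivation k (Laurent4 k) (Laurent4 k)) :
    Module.End k (Laurent4 k) := (δ : Laurent4 k →ₗ[k] Laurent4 k)

theorem derEnd_smul_euler (f : Laurent4 k) (j : Fin 4) :
    derEnd (f • euler k j) = mulOp k f * eulerEnd k j :=
  LinearMap.ext fun _ => rfl

theorem derEnd_mul_mulOp (δ : Derivation k (Laurent4 k) (Laurent4 k)) (f : Laurent4 k) :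
    derEnd δ * mulOp k f = mulOp k f * derEnd δ + mulOp k (δ f) := by
  refine LinearMap.ext fun x => ?_
  simp [derEnd, mulOp_apply, mul_comm x]

theorem derEnd_commute_mulOp {δ : Derivation k (Laurent4 k) (Laurent4 k)} {f : Laurent4 k}
    (h : δ f = 0) : mulOp k f * derEnd δ = derEnd δ * mulOp k f := by
  rw [derEnd_mul_mulOp, h, map_zero, add_zero]

theorem derEnd_mul_diffOp {δ : Derivation k (Laurent4 k) (Laurent4 k)}
    (h0 : derEnd δ * eulerEnd k 0 = eulerEnd k 0 * derEnd δ)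
    (h1 : derEnd δ * eulerEnd k 1 = eulerEnd k 1 * derEnd δ) (a b c : Laurent4 k) :
    derEnd δ * diffOp a b c = diffOp a b c * derEnd δ + diffOp (δ a) (δ b) (δ c) := by
  simp only [diffOp, mul_add, add_mul, mul_assoc, ← h0, ← h1]
  simp only [← mul_assoc, derEnd_mul_mulOp, add_mul]
  abel

theorem derEnd_commute_eulerEnd (j : Fin 4) (hj : j ≠ 3) :
    derEnd (lvarInv k 3 • euler k 3) * eulerEnd k j =
      eulerEnd k j * derEnd (lvarInv k 3 • euler k 3) := by
  rw [derEnd_smul_euler, ← mul_assoc, eulerEnd_mul_mulOp, euler_lvarInv, if_neg hj, map_zero,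
    add_zero, mul_assoc, eulerEnd_commute, mul_assoc]

variable [CharZero k]

/-- The representation of the double of the Jordan plane by differential operators. -/
noncomputable def jordanRep (k : Type*) [Field k] [CharZero k] :
    JordanDouble k →ₐ[k] Module.End k (Laurent4 k) :=
  RingQuot.liftAlgHom k ⟨FreeAlgebra.lift k (jordanOp k), fun _ _ h => jordanOp_rel h⟩

theorem jordanRep_jgen (a : JordanGen) : jordanRep k (jgen k a) = jordanOp k a := by
  simp [jordanRep, jgen]

/-- The case of a generator acting as multiplication by `f`: the commutator with a derivation `δ` is
multiplication by `δ f`. -/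
theorem eq_zero_of_function_adjoin_insert {s : Set (JordanDouble k)} {t : JordanDouble k}
    (hinj : ∀ x ∈ adjoin k s, jordanRep k x = 0 → x = 0) (h : ∀ a ∈ s, NormalizesAt k s t a)
    (δ : Derivation k (Laurent4 k) (Laurent4 k)) {f e e' : Laurent4 k}
    (hs : ∀ a ∈ s, jordanRep k a * derEnd δ = derEnd δ * jordanRep k a)
    (ht : jordanRep k t = mulOp k f) (hf : δ f = e) (he : δ e = 0) (hee : e * e' = 1) :
    ∀ x ∈ adjoin k (insert t s), jordanRep k x = 0 → x = 0 :=
  eq_zero_of_mem_adjoin_insert (jordanRep k) hinj h (derEnd δ) (mulOp k e) hs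
    (by rw [ht, derEnd_mul_mulOp, hf, add_sub_cancel_left])
    (by rw [derEnd_mul_mulOp, he, map_zero, add_zero]) (isUnit_mulOp hee)

/-- Along the chain, each new generator other than `g⁻¹` needs an operator `c` that commutes with
the images of the earlier generators and has a unit commutator with the new one. Such a `c` may be
any linear map, so `E₂` and `E₃` are allowed. -/
theorem jordanRep_injective : Function.Injective (jordanRep k) := by
  have hX (j : Fin 4) := lvar_mul_lvarInv (k := k) j
  have hg : jordanRep k (jgen k g) = mulOp k (jordanG k) := by
    rw [jordanRep_jgen, jordanOp, diffOp_zero_zero]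
  have hgi : jordanRep k (jgen k gInv) = mulOp k (lvarInv k 1 ^ 2 * lvarInv k 2) := by
    rw [jordanRep_jgen, jordanOp, diffOp_zero_zero]
  have hx : jordanRep k (jgen k x) = mulOp k (lvar k 0) := by
    rw [jordanRep_jgen, jordanOp, diffOp_zero_zero]
  have hu : jordanRep k (jgen k u) = mulOp k (lvarInv k 0 * jordanW k) := by
    rw [jordanRep_jgen, jordanOp, diffOp_zero_zero]
  have hE2G : euler k 2 (jordanG k) = jordanG k := by
    simp [jordanG, euler_lvar, pow_two, mul_comm]
  have hE3G : euler k 3 (jordanG k) = 0 := by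
    simp [jordanG, euler_lvar, pow_two]
  have hE3W : euler k 3 (jordanW k) = 0 := by
    simp [jordanW, euler_lvar, hE3G, euler_two]
  rw [injective_iff_map_eq_zero]
  suffices h : ∀ x ∈ adjoin k (Set.range (jgen k)), jordanRep k x = 0 → x = 0 from
    fun x => h x (adjoin_range_jgen (k := k) ▸ mem_top)
  rw [jgen_chain_eq]
  have step0 : ∀ x ∈ adjoin k (∅ : Set (JordanDouble k)), jordanRep k x = 0 → x = 0 := by
    intro x hx h0
    rw [adjoin_empty, Algebra.mem_bot] at hx
    obtain ⟨r, rfl⟩ := hx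
    rw [AlgHom.commutes] at h0
    rw [(map_eq_zero_iff _ (algebraMap k (Module.End k (Laurent4 k))).injective).1 h0, map_zero]
  have step1 : ∀ x ∈ adjoin k ({jgen k g} : Set (JordanDouble k)), jordanRep k x = 0 → x = 0 := by
    rw [← insert_empty_eq]
    -- `g` is detected by `∂₂`, with `∂₂G = X₁²`.
    refine eq_zero_of_function_adjoin_insert step0 (by simp) (lvarInv k 2 • euler k 2)
      (e := lvar k 1 ^ 2) (e' := lvarInv k 1 ^ 2) (by simp) hg ?_ ?_ ?_
    · rw [Derivation.smul_apply, hE2G, jordanG, smul_eq_mul]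
      linear_combination lvar k 1 ^ 2 * hX 2
    · simp [pow_two, euler_lvar]
    · rw [← mul_pow, hX, one_pow]
  have step2 := eq_zero_of_mem_adjoin_insert_inverse (jordanRep k) step1 normalizesAt_gInv
    (subset_adjoin rfl) jgen_g_mul_gInv jgen_gInv_mul_g
  have step3 := eq_zero_of_function_adjoin_insert step2 normalizesAt_x
    (lvarInv k 0 • euler k 0) (e := 1) (e' := 1) (by
      simp only [Set.mem_insert_iff, Set.mem_singleton_iff, forall_eq_or_imp, forall_eq, hg, hgi]
      constructor <;> apply derEnd_commute_mulOp
      · simp [euler_lvarInv, pow_two]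
      · simp [euler_jordanG_zero]) hx (by
      simp [euler_lvar, mul_comm, hX]) (by simp) (one_mul 1)
  -- `E₁G = 2G` and `E₂G = G`, so `X₁⁻¹(E₁ - 2E₂)` kills `X₀` and `G`, and it sends `W` to `1`.
  have step4 := eq_zero_of_function_adjoin_insert step3 normalizesAt_u
    (lvarInv k 1 • (euler k 1 - 2 • euler k 2)) (e := lvarInv k 0) (e' := lvar k 0) (by
      simp only [Set.mem_insert_iff, Set.mem_singleton_iff, forall_eq_or_imp, forall_eq, hg, hgi,
        hx]
      refine ⟨?_, ?_, ?_⟩ <;> apply derEnd_commute_mulOp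
      · simp [euler_lvar]
      · simp [euler_lvarInv, pow_two]
        ring
      · simp [euler_jordanG_one, hE2G]) hu (by
      simp [jordanW, euler_lvar, euler_lvarInv, hE2G, euler_jordanG_one, euler_two]
      linear_combination lvarInv k 0 * hX 1) (by simp [euler_lvarInv]) (by rw [mul_comm, hX])
  have step5 := eq_zero_of_mem_adjoin_insert (jordanRep k) step4 normalizesAt_zeta
    (mulOp k (lvar k 0)) (mulOp k (-lvar k 0)) (by
      simp only [Set.mem_insert_iff, Set.mem_singleton_iff, forall_eq_or_imp, forall_eq, hg, hgi,
        hx, hu]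
      exact ⟨mulOp_commute _ _, trivial, mulOp_commute _ _, mulOp_commute _ _⟩) (by
      rw [jordanRep_jgen, jordanOp, ← diffOp_zero_zero, ← diffOp_zero_zero, mul_diffOp, diffOp_mul,
        diffOp_sub]
      apply diffOp_congr <;> simp [euler_lvar]) (mulOp_commute _ _)
      (isUnit_mulOp (g := -lvarInv k 0) (by rw [neg_mul_neg, hX]))
  -- Multiplication by `X₁` commutes with `ζ = E₀` but not with `y`, which contains `E₁`.
  have step6 := eq_zero_of_mem_adjoin_insert (jordanRep k) step5 normalizesAt_y
    (mulOp k (lvar k 1)) (mulOp k (half k * lvar k 0 * lvar k 1)) (by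
      simp only [Set.mem_insert_iff, Set.mem_singleton_iff, forall_eq_or_imp, forall_eq, hg, hgi,
        hx, hu]
      refine ⟨?_, mulOp_commute _ _, mulOp_commute _ _, mulOp_commute _ _, mulOp_commute _ _⟩
      rw [jordanRep_jgen, jordanOp, ← diffOp_zero_zero, mul_diffOp, diffOp_mul]
      apply diffOp_congr <;> simp [euler_lvar]) (by
      rw [jordanRep_jgen, jordanOp, ← diffOp_zero_zero, ← diffOp_zero_zero, mul_diffOp, diffOp_mul,
        diffOp_sub]
      apply diffOp_congr <;> simp [euler_lvar]) (mulOp_commute _ _)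
      (isUnit_mulOp (g := 2 * lvarInv k 0 * lvarInv k 1) (by
        linear_combination lvar k 0 * lvarInv k 0 * lvar k 1 * lvarInv k 1 * two_mul_half (k := k) +
          lvar k 0 * lvarInv k 0 * hX 1 + hX 0))
  have hv := derEnd_mul_diffOp (k := k) (derEnd_commute_eulerEnd 0 (by decide))
    (derEnd_commute_eulerEnd 1 (by decide))
  -- `X₃` occurs only in `v`, so `∂₃` detects it, with commutator `X₀⁻¹X₁`.
  refine eq_zero_of_mem_adjoin_insert (jordanRep k) step6 normalizesAt_v
    (derEnd (lvarInv k 3 • euler k 3)) (mulOp k (lvarInv k 0 * lvar k 1)) ?_ ?_ ?_ ?_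
  · have hzero (a : JordanGen) (ha : a ≠ v) : jordanRep k (jgen k a) *
        derEnd (lvarInv k 3 • euler k 3) =
          derEnd (lvarInv k 3 • euler k 3) * jordanRep k (jgen k a) := by
      have hd (a b c : Laurent4 k) (ha : euler k 3 a = 0) (hb : euler k 3 b = 0)
          (hc : euler k 3 c = 0) : diffOp a b c * derEnd (lvarInv k 3 • euler k 3) =
          derEnd (lvarInv k 3 • euler k 3) * diffOp a b c := by
        rw [hv, Derivation.smul_apply, Derivation.smul_apply, Derivation.smul_apply, ha, hb, hc,
          smul_zero, diffOp_zero_zero, map_zero, add_zero]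
      rw [jordanRep_jgen]
      cases a <;> first | exact absurd rfl ha | skip
      all_goals
        apply hd <;> simp [hE3G, hE3W, euler_lvar, euler_lvarInv, pow_two, euler_half]
    simp only [Set.mem_insert_iff, Set.mem_singleton_iff, forall_eq_or_imp, forall_eq]
    exact ⟨hzero _ (by simp), hzero _ (by simp), hzero _ (by simp), hzero _ (by simp),
      hzero _ (by simp), hzero _ (by simp)⟩
  · rw [jordanRep_jgen, jordanOp, hv, add_sub_cancel_left, ← diffOp_zero_zero]
    apply diffOp_congr
    · simp only [Derivation.smul_apply, Derivation.leibniz, map_add, hE3G, euler_lvar,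
        euler_lvarInv, euler_two, smul_eq_mul]
      simp [-mul_eq_mul_left_iff, -mul_eq_mul_right_iff]
      linear_combination lvarInv k 0 * lvar k 1 * hX 3
    · simp [hE3G, euler_lvar, euler_lvarInv, euler_three]
    · simp [hE3W, euler_lvarInv, euler_half]
  · refine (derEnd_commute_mulOp ?_).symm
    simp [euler_lvar, euler_lvarInv]
  · exact isUnit_mulOp (g := lvar k 0 * lvarInv k 1)
      (by linear_combination lvar k 1 * lvarInv k 1 * hX 0 + hX 1)

end JordanRep

/-! ### The image of `𝒟` generates the skew field of all the operators. -/

section OperatorSkewField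

open Algebra

variable (k : Type*) [Field k]

/-- The algebra of differential operators as a type. -/
def LaurentOps : Type _ := laurentDiffOps k

noncomputable instance : Ring (LaurentOps k) := inferInstanceAs (Ring (laurentDiffOps k))

noncomputable instance : Algebra k (LaurentOps k) := by
  exact inferInstanceAs (Algebra k (laurentDiffOps k))

instance [CharZero k] : IsNoetherianDomain (LaurentOps k) := laurentDiffOps_isNoetherianDomain

/-- The inclusion of the algebra of differential operators into all linear maps. -/
noncomputable def opsToEnd : LaurentOps k →ₐ[k] Module.End k (Laurent4 k) := by
  exact (laurentDiffOps k).val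

variable {k}

theorem opsToEnd_injective : Function.Injective (opsToEnd k) := Subtype.val_injective

theorem opsToEnd_mem (a : LaurentOps k) : opsToEnd k a ∈ laurentDiffOps k := Subtype.prop a

theorem exists_opsToEnd_eq {t : Module.End k (Laurent4 k)} (h : t ∈ laurentDiffOps k) :
    ∃ a, opsToEnd k a = t := ⟨⟨t, h⟩, rfl⟩

/-- Restriction of the codomain to the algebra of differential operators. -/
noncomputable def liftToOps {A : Type*} [Ring A] [Algebra k A]
    (φ : A →ₐ[k] Module.End k (Laurent4 k)) (h : ∀ a, φ a ∈ laurentDiffOps k) :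
    A →ₐ[k] LaurentOps k := by
  exact φ.codRestrict (laurentDiffOps k) h

theorem opsToEnd_liftToOps {A : Type*} [Ring A] [Algebra k A]
    (φ : A →ₐ[k] Module.End k (Laurent4 k)) (h : ∀ a, φ a ∈ laurentDiffOps k) (a : A) :
    opsToEnd k (liftToOps φ h a) = φ a := rfl

theorem mulOp_lvar_ne_zero (j : Fin 4) : mulOp k (lvar k j) ≠ 0 := (isUnit_mulOp_lvar j).ne_zero

theorem mulOp_lvar_mem_laurentDiffOps (j : Fin 4) : mulOp k (lvar k j) ∈ laurentDiffOps k :=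
  mulOp_mem_laurentDiffOps (subset_adjoin (.inl ⟨j, rfl⟩))

theorem mulOp_lvarInv_mem_laurentDiffOps (j : Fin 4) : mulOp k (lvarInv k j) ∈ laurentDiffOps k :=
  mulOp_mem_laurentDiffOps (subset_adjoin (.inr ⟨j, rfl⟩))

theorem diffOp_mem_laurentDiffOps {a b c : Laurent4 k} (ha : mulOp k a ∈ laurentDiffOps k)
    (hb : mulOp k b ∈ laurentDiffOps k) (hc : mulOp k c ∈ laurentDiffOps k) :
    diffOp a b c ∈ laurentDiffOps k :=
  add_mem (add_mem ha (mul_mem hb eulerEnd_zero_mem)) (mul_mem hc eulerEnd_one_mem)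

theorem jordanOp_mem_laurentDiffOps (a : JordanGen) : jordanOp k a ∈ laurentDiffOps k := by
  have hX (j : Fin 4) := mulOp_lvar_mem_laurentDiffOps (k := k) j
  have hY (j : Fin 4) := mulOp_lvarInv_mem_laurentDiffOps (k := k) j
  have h1 : mulOp k 1 ∈ laurentDiffOps k := by
    rw [map_one]
    exact one_mem _
  have h2 : mulOp k 2 ∈ laurentDiffOps k := by
    rw [← one_add_one_eq_two, map_add]
    exact add_mem h1 h1
  have h3 : mulOp k 3 ∈ laurentDiffOps k := by
    rw [← two_add_one_eq_three, map_add]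
    exact add_mem h2 h1
  have h0 : mulOp k 0 ∈ laurentDiffOps k := by
    rw [map_zero]
    exact zero_mem _
  have hh : mulOp k (half k) ∈ laurentDiffOps k := by
    rw [half, AlgHom.commutes]
    exact algebraMap_mem _ _
  have hG : mulOp k (jordanG k) ∈ laurentDiffOps k := by
    rw [jordanG, map_mul, map_pow]
    exact mul_mem (pow_mem (hX 1) 2) (hX 2)
  have hW : mulOp k (jordanW k) ∈ laurentDiffOps k := by
    rw [jordanW, map_sub, map_sub, map_mul]
    exact sub_mem (sub_mem (hX 1) h2) (mul_mem h2 hG)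
  cases a
  · refine diffOp_mem_laurentDiffOps ?_ h0 h0
    rw [map_mul]
    exact mul_mem (hY 0) hW
  · refine diffOp_mem_laurentDiffOps ?_ ?_ ?_
    · rw [map_mul, map_add, map_add, map_mul, map_mul]
      exact mul_mem (hY 0) (add_mem (add_mem (mul_mem (hX 1) (hX 3)) h2) (mul_mem h2 hG))
    · rw [map_mul, map_sub, map_sub, map_mul]
      exact mul_mem (hY 0) (sub_mem (sub_mem (hX 1) h1) (mul_mem h3 hG))
    · rw [map_mul, map_mul]
      exact mul_mem hh (mul_mem (hY 0) hW)
  · exact diffOp_mem_laurentDiffOps h0 h1 h0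
  · exact diffOp_mem_laurentDiffOps hG h0 h0
  · refine diffOp_mem_laurentDiffOps ?_ h0 h0
    rw [map_mul, map_pow]
    exact mul_mem (pow_mem (hY 1) 2) (hY 2)
  · exact diffOp_mem_laurentDiffOps (hX 0) h0 h0
  · refine diffOp_mem_laurentDiffOps h0 ?_ ?_ <;>
    · rw [map_mul, map_neg]
      exact mul_mem (neg_mem hh) (hX 0)

variable [CharZero k]

/-- The skew field of fractions of the algebra of differential operators. -/
abbrev LaurentSkewField (k : Type*) [Field k] [CharZero k] : Type _ := SkewFrac (LaurentOps k)

/-- The differential operators that lie in a given subfield of the skew field of fractions. -/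
noncomputable def opsInSubfield (F : Subfield (LaurentSkewField k))
    (hF : ∀ r : k, algebraMap k (LaurentSkewField k) r ∈ F) :
    Subalgebra k (Module.End k (Laurent4 k)) where
  carrier := {t | ∃ a, opsToEnd k a = t ∧ toSkewFrac k (LaurentOps k) a ∈ F}
  mul_mem' := by
    rintro _ _ ⟨a, rfl, ha⟩ ⟨b, rfl, hb⟩
    exact ⟨a * b, map_mul _ _ _, by rw [map_mul]; exact mul_mem ha hb⟩
  add_mem' := by
    rintro _ _ ⟨a, rfl, ha⟩ ⟨b, rfl, hb⟩
    exact ⟨a + b, map_add _ _ _, by rw [map_add]; exact add_mem ha hb⟩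
  algebraMap_mem' r := ⟨algebraMap k _ r, AlgHom.commutes _ _, by
    rw [AlgHom.commutes]; exact hF r⟩

variable {F : Subfield (LaurentSkewField k)}
  {hF : ∀ r : k, algebraMap k (LaurentSkewField k) r ∈ F}

theorem mem_opsInSubfield {a : LaurentOps k} :
    opsToEnd k a ∈ opsInSubfield F hF ↔ toSkewFrac k (LaurentOps k) a ∈ F :=
  ⟨fun ⟨_, h, hb⟩ => opsToEnd_injective h ▸ hb, fun h => ⟨a, rfl, h⟩⟩

/-- Division in the skew field, phrased for concrete operators: the quotient must be known in
advance to be a differential operator. -/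
theorem mem_opsInSubfield_of_mul {a b : Module.End k (Laurent4 k)} (ha : a ∈ opsInSubfield F hF)
    (h0 : a ≠ 0) (hb : b ∈ laurentDiffOps k) (hab : a * b ∈ opsInSubfield F hF) :
    b ∈ opsInSubfield F hF := by
  obtain ⟨a, rfl, haF⟩ := ha
  obtain ⟨b, rfl⟩ := exists_opsToEnd_eq hb
  rw [← map_mul, mem_opsInSubfield] at hab
  rw [mem_opsInSubfield]
  exact SkewFrac.mem_subfield_of_mul (fun h => h0 (by rw [h, map_zero])) haF hab

theorem subfield_eq_top_of_mem_opsInSubfield (h : ∀ j, mulOp k (lvar k j) ∈ opsInSubfield F hF)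
    (h0 : eulerEnd k 0 ∈ opsInSubfield F hF) (h1 : eulerEnd k 1 ∈ opsInSubfield F hF) : F = ⊤ := by
  have hle : laurentDiffOps k ≤ opsInSubfield F hF := by
    refine adjoin_le ?_
    rintro _ (rfl | rfl | ⟨_, ⟨j, rfl⟩ | ⟨j, rfl⟩, rfl⟩)
    · exact h1
    · exact h0
    · exact h j
    · refine mem_opsInSubfield_of_mul (h j) (mulOp_lvar_ne_zero j)
        (mulOp_lvarInv_mem_laurentDiffOps j) ?_
      rw [← map_mul, lvar_mul_lvarInv, map_one]
      exact one_mem _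
  refine SkewFrac.subfield_eq_top (k := k) fun a => ?_
  exact mem_opsInSubfield.1 (hle (opsToEnd_mem a))

theorem jordanRep_mem (a : JordanDouble k) : jordanRep k a ∈ laurentDiffOps k := by
  have h : a ∈ adjoin k (Set.range (jgen k)) := adjoin_range_jgen (k := k) ▸ mem_top
  induction h using adjoin_induction with
  | mem x hx =>
    obtain ⟨b, rfl⟩ := hx
    rw [jordanRep_jgen]
    exact jordanOp_mem_laurentDiffOps b
  | algebraMap r =>
    rw [AlgHom.commutes]
    exact algebraMap_mem _ r
  | add x y _ _ hx hy =>
    rw [map_add]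
    exact add_mem hx hy
  | mul x y _ _ hx hy =>
    rw [map_mul]
    exact mul_mem hx hy

/-- The embedding of the double of the Jordan plane into the algebra of differential operators. -/
noncomputable def jordanToOps (k : Type*) [Field k] [CharZero k] :
    JordanDouble k →ₐ[k] LaurentOps k :=
  liftToOps (jordanRep k) jordanRep_mem

theorem jordanToOps_injective : Function.Injective (jordanToOps k) := fun a b h =>
  jordanRep_injective (by
    rw [← opsToEnd_liftToOps (jordanRep k) jordanRep_mem,
      ← opsToEnd_liftToOps (jordanRep k) jordanRep_mem]
    exact congrArg _ h)

/-- The domain property passes to subrings, noetherianity does not; the first comes from the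
embedding, the second from the chain of generators. -/
instance jordanDouble_isNoetherianDomain : IsNoetherianDomain (JordanDouble k) :=
  have : IsDomain (JordanDouble k) := jordanToOps_injective.isDomain (jordanToOps k).toRingHom
  isNormalizingChain_jgen.isNoetherianDomain adjoin_range_jgen

/-- The operators are recovered as `X₁ = xu + 2 + 2g`, `X₂ = X₁⁻²g`, `E₀ = ζ`, `E₁ = -2x⁻¹y - ζ`,
and `X₃` from `xv`. -/
theorem subfield_eq_top_of_jordanRep_mem (h : ∀ a, jordanRep k a ∈ opsInSubfield F hF) :
    F = ⊤ := by
  have hX0 := lvar_mul_lvarInv (k := k) 0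
  have hh := two_mul_half (k := k)
  have hgen (a : JordanGen) : jordanOp k a ∈ opsInSubfield F hF := jordanRep_jgen (k := k) a ▸ h _
  have hg := hgen .g
  have hx := hgen .x
  have hz := hgen .zeta
  have hu := hgen .u
  have hy := hgen .y
  have hv := hgen .v
  simp only [jordanOp] at hg hx hz hu hy hv
  have h2 : diffOp (2 : Laurent4 k) 0 0 ∈ opsInSubfield F hF := by
    rw [diffOp_zero_zero, ← one_add_one_eq_two, map_add, map_one]
    exact add_mem (one_mem _) (one_mem _)
  have hw : diffOp (jordanW k) 0 0 ∈ opsInSubfield F hF := by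
    convert mul_mem hx hu using 1
    rw [mul_diffOp]
    apply diffOp_congr <;> [skip; simp; simp]
    linear_combination -jordanW k * hX0
  have hX1 : diffOp (lvar k 1) 0 0 ∈ opsInSubfield F hF := by
    convert add_mem (add_mem hw h2) (mul_mem h2 hg) using 1
    rw [mul_diffOp, diffOp_add, diffOp_add]
    apply diffOp_congr <;> [rw [jordanW]; simp; simp]
    ring
  have hX2 : diffOp (lvar k 2) 0 0 ∈ opsInSubfield F hF := by
    rw [diffOp_zero_zero] at hX1 hg ⊢
    refine mem_opsInSubfield_of_mul (pow_mem hX1 2)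
      ((isUnit_mulOp_lvar 1).pow 2).ne_zero (mulOp_lvar_mem_laurentDiffOps 2) ?_
    rwa [← map_pow, ← map_mul]
  have hE : diffOp (0 : Laurent4 k) 1 1 ∈ opsInSubfield F hF := by
    refine mem_opsInSubfield_of_mul (a := diffOp (lvar k 0) 0 0) hx
      (by rw [diffOp_zero_zero]; exact mulOp_lvar_ne_zero 0) ?_ ?_
    · exact diffOp_mem_laurentDiffOps (by simp) (by simp) (by simp)
    · convert neg_mem (add_mem hy hy) using 1
      rw [mul_diffOp, diffOp_add, diffOp_neg]
      apply diffOp_congr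
      · simp
      · linear_combination -lvar k 0 * hh
      · linear_combination -lvar k 0 * hh
  have hE1 : diffOp (0 : Laurent4 k) 0 1 ∈ opsInSubfield F hF := by
    convert sub_mem hE hz using 1
    rw [diffOp_sub]
    apply diffOp_congr <;> simp
  -- In `xv` every term except `X₁X₃` is already available; subtract those and divide by `X₁`.
  have hX3 : diffOp (lvar k 3) 0 0 ∈ opsInSubfield F hF := by
    refine mem_opsInSubfield_of_mul hX1 (by rw [diffOp_zero_zero]; exact mulOp_lvar_ne_zero 1)
      (by rw [diffOp_zero_zero]; exact mulOp_lvar_mem_laurentDiffOps 3) ?_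
    have hfun : diffOp (lvar k 1 - 1 - 3 * jordanG k) 0 0 ∈ opsInSubfield F hF := by
      convert sub_mem (sub_mem hX1 (one_mem _)) (add_mem hg (mul_mem h2 hg)) using 1
      rw [mul_diffOp, ← diffOp_one, diffOp_sub, diffOp_add, diffOp_sub]
      apply diffOp_congr <;> [skip; simp; simp]
      ring
    have hhw : diffOp (half k * jordanW k) 0 0 ∈ opsInSubfield F hF := by
      convert Subalgebra.smul_mem _ hw (1 / 2) using 1
      rw [half_smul_diffOp]
      apply diffOp_congr <;> simp
    convert sub_mem (mul_mem hx hv) (add_mem (add_mem h2 (mul_mem h2 hg))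
      (add_mem (mul_mem hfun hz) (mul_mem hhw hE1))) using 1
    simp only [mul_diffOp, diffOp_add, diffOp_sub]
    apply diffOp_congr <;> simp
    · linear_combination -(lvar k 1 * lvar k 3 + 2 + 2 * jordanG k) * hX0
    · linear_combination -(lvar k 1 - 1 - 3 * jordanG k) * hX0
    · linear_combination -(half k * jordanW k) * hX0
  refine subfield_eq_top_of_mem_opsInSubfield (hF := hF) (fun j => ?_) ?_ ?_
  · rw [← diffOp_zero_zero]
    fin_cases j
    exacts [hx, hX1, hX2, hX3]
  · simpa [diffOp] using hz
  · simpa [diffOp] using hE1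

/-- The skew field of fractions of the double of the Jordan plane. -/
noncomputable def jordanSkewFracEquiv (k : Type*) [Field k] [CharZero k] :
    SkewFrac (JordanDouble k) ≃ₐ[k] LaurentSkewField k :=
  skewFracEquiv ((toSkewFrac k (LaurentOps k)).comp (jordanToOps k))
    ((toSkewFrac_injective (k := k)).comp jordanToOps_injective) fun F h => by
      have hF (r : k) : algebraMap k (LaurentSkewField k) r ∈ F := by
        simpa using h (algebraMap k _ r)
      exact subfield_eq_top_of_jordanRep_mem (hF := hF) fun a =>
        opsToEnd_liftToOps (jordanRep k) jordanRep_mem a ▸ mem_opsInSubfield.2 (h a)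

end OperatorSkewField

/-! ### Weyl algebras: embeddings and noetherianity. -/

section WeylEmbedding

open Algebra

variable {K : Type*} [Field K]

/-- The generators of the Weyl algebra. -/
noncomputable def wgen {n : ℕ} (K : Type*) [Field K] (a : WeylGen n) : WeylAlgebra n K :=
  RingQuot.mkAlgHom K (WeylRel n K) (FreeAlgebra.ι K a)

theorem weyl_relation {n : ℕ} {a b : FreeAlgebra K (WeylGen n)} (h : WeylRel n K a b) :
    FreeAlgebra.lift K (wgen K) a = FreeAlgebra.lift K (wgen K) b := by
  have : FreeAlgebra.lift K (wgen K) = RingQuot.mkAlgHom K (WeylRel n K) := by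
    ext a
    simp [wgen]
  rw [this]
  exact RingQuot.mkAlgHom_rel K h

theorem adjoin_range_wgen {n : ℕ} : adjoin K (Set.range (wgen (n := n) K)) = ⊤ := by
  have h : Set.range (wgen (n := n) K) =
      RingQuot.mkAlgHom K (WeylRel n K) '' Set.range (FreeAlgebra.ι K) := by
    rw [← Set.range_comp]
    rfl
  rw [h, ← AlgHom.map_adjoin, FreeAlgebra.adjoin_range_ι, Algebra.map_top, AlgHom.range_eq_top]
  exact RingQuot.mkAlgHom_surjective K _

theorem wgen_p_q {n : ℕ} (i j : Fin n) :
    wgen K (.p i) * wgen K (.q j) - wgen K (.q j) * wgen K (.p i) = if i = j then 1 else 0 := by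
  split_ifs with h
  · subst h
    simpa using weyl_relation (K := K) (.p_q i)
  · rw [sub_eq_zero]
    simpa using weyl_relation (K := K) (.p_q_comm i j h)

/-- Commutators of generators are `0` or `±1`, so the generators form a normalizing chain in any
order. -/
theorem commutator_wgen_mem {n : ℕ} (s : Set (WeylAlgebra n K)) (a b : WeylGen n) :
    wgen K a * wgen K b - wgen K b * wgen K a ∈ adjoin K s := by
  rcases a with i | i <;> rcases b with j | j
  · convert zero_mem (adjoin K s)
    rw [sub_eq_zero]
    simpa using weyl_relation (K := K) (.p_p_comm i j)
  · rw [wgen_p_q]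
    split_ifs
    exacts [one_mem _, zero_mem _]
  · rw [← neg_sub, wgen_p_q]
    split_ifs
    exacts [neg_mem (one_mem _), neg_mem (zero_mem _)]
  · convert zero_mem (adjoin K s)
    rw [sub_eq_zero]
    simpa using weyl_relation (K := K) (.q_q_comm i j)

theorem normalizesAt_wgen {n : ℕ} {S : Set (WeylGen n)} (a : WeylGen n) :
    ∀ b ∈ wgen K '' S, NormalizesAt K (wgen K '' S) (wgen K a) b := by
  rintro _ ⟨b, hb, rfl⟩
  exact .of_commutator (subset_adjoin ⟨b, hb, rfl⟩) (commutator_wgen_mem _ a b)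

theorem isNormalizingChain_wgen {n : ℕ} {S : Set (WeylGen n)} (hS : S.Finite) :
    IsNormalizingChain K (wgen K '' S) := by
  induction S, hS using Set.Finite.induction_on with
  | empty => simpa using IsNormalizingChain.empty
  | @insert a S _ _ ih =>
    rw [Set.image_insert_eq]
    exact ih.cons (normalizesAt_wgen a)

variable {W : Type*} [Ring W] [Algebra K W] {n : ℕ}

/-- Elements `P i`, `Q i` of an algebra that satisfy the relations of the Weyl algebra. -/
structure IsWeylSystem (P Q : Fin n → W) : Prop where
  p_q : ∀ i j, P i * Q j - Q j * P i = if i = j then 1 else 0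
  p_p : ∀ i j, P i * P j = P j * P i
  q_q : ∀ i j, Q i * Q j = Q j * Q i

/-- The images of the generators under the representation given by a Weyl system. -/
def weylImage (P Q : Fin n → W) : WeylGen n → W
  | .p i => P i
  | .q i => Q i

variable {P Q : Fin n → W}

/-- The representation of the Weyl algebra that is given by a Weyl system. -/
noncomputable def weylLift (K : Type*) [Field K] [Algebra K W] (h : IsWeylSystem P Q) :
    WeylAlgebra n K →ₐ[K] W :=
  RingQuot.liftAlgHom K ⟨FreeAlgebra.lift K (weylImage P Q), fun a b hab => by
    cases hab with
    | p_q i => simpa [weylImage] using h.p_q i i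
    | p_q_comm i j hij =>
      rw [← sub_eq_zero]
      simpa [weylImage, hij] using h.p_q i j
    | p_p_comm i j => simpa [weylImage] using h.p_p i j
    | q_q_comm i j => simpa [weylImage] using h.q_q i j⟩

theorem weylLift_wgen (h : IsWeylSystem P Q) (a : WeylGen n) :
    weylLift K h (wgen K a) = weylImage P Q a := by
  simp [weylLift, wgen]

/-- The `q i` are adjoined to the scalars before the `p i`. Commutation with `P i` detects `q i`,
and commutation with `Q i` then detects `p i`, with commutators `1` and `-1`. -/
theorem weylLift_injective [CharZero K] [Nontrivial W] (h : IsWeylSystem P Q) :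
    Function.Injective (weylLift K h) := by
  have hinj0 : ∀ x ∈ adjoin K (wgen K '' (∅ : Set (WeylGen n))), weylLift K h x = 0 → x = 0 := by
    intro x hx h0
    rw [Set.image_empty, adjoin_empty, Algebra.mem_bot] at hx
    obtain ⟨r, rfl⟩ := hx
    rw [AlgHom.commutes] at h0
    rw [(map_eq_zero_iff _ (algebraMap K W).injective).1 h0, map_zero]
  have hq : ∀ S : Finset (Fin n), ∀ x ∈ adjoin K (wgen K '' (WeylGen.q '' (S : Set (Fin n)))),
      weylLift K h x = 0 → x = 0 := by
    classical
    intro S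
    induction S using Finset.induction_on with
    | empty => simpa using hinj0
    | insert i S hi ih =>
      rw [Finset.coe_insert, Set.image_insert_eq, Set.image_insert_eq]
      refine eq_zero_of_mem_adjoin_insert (weylLift K h) ih (normalizesAt_wgen _) (P i) 1 ?_ ?_
        (by simp) isUnit_one
      · rintro _ ⟨_, ⟨j, hj, rfl⟩, rfl⟩
        rw [weylLift_wgen, weylImage, eq_comm, ← sub_eq_zero, h.p_q, if_neg]
        rintro rfl
        exact hi hj
      · rw [weylLift_wgen, weylImage, h.p_q, if_pos rfl]
  have hp : ∀ S : Finset (Fin n), ∀ x ∈ adjoin K (wgen K '' (WeylGen.p '' (S : Set (Fin n)) ∪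
      Set.range WeylGen.q)), weylLift K h x = 0 → x = 0 := by
    classical
    intro S
    induction S using Finset.induction_on with
    | empty => simpa using hq Finset.univ
    | insert i S hi ih =>
      rw [Finset.coe_insert, Set.image_insert_eq, Set.insert_union, Set.image_insert_eq]
      refine eq_zero_of_mem_adjoin_insert (weylLift K h) ih (normalizesAt_wgen _) (Q i) (-1) ?_ ?_
        (by simp) isUnit_one.neg
      · rintro _ ⟨_, ⟨j, hj, rfl⟩ | ⟨j, rfl⟩, rfl⟩
        · rw [weylLift_wgen, weylImage, ← sub_eq_zero, h.p_q, if_neg]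
          rintro rfl
          exact hi hj
        · rw [weylLift_wgen, weylImage, h.q_q]
      · rw [weylLift_wgen, weylImage, ← neg_sub, h.p_q, if_pos rfl]
  rw [injective_iff_map_eq_zero]
  intro x
  refine hp Finset.univ x ?_
  have huniv : WeylGen.p '' ((Finset.univ : Finset (Fin n)) : Set (Fin n)) ∪ Set.range WeylGen.q =
      Set.univ := by
    rw [Set.eq_univ_iff_forall]
    rintro (i | i) <;> simp
  rw [huniv, Set.image_univ, adjoin_range_wgen]
  exact mem_top

instance : Finite (WeylGen n) := by
  refine Finite.of_surjective (fun a : Fin n ⊕ Fin n => a.elim WeylGen.p WeylGen.q) ?_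
  rintro (i | i)
  exacts [⟨.inl i, rfl⟩, ⟨.inr i, rfl⟩]

theorem weylAlgebra_isNoetherianDomain [CharZero K] [IsDomain W] (h : IsWeylSystem P Q) :
    IsNoetherianDomain (WeylAlgebra n K) := by
  have : IsDomain (WeylAlgebra n K) :=
    (weylLift_injective (K := K) h).isDomain (weylLift K h).toRingHom
  refine (isNormalizingChain_wgen (K := K) (n := n) Set.finite_univ).isNoetherianDomain ?_
  rw [Set.image_univ, adjoin_range_wgen]

end WeylEmbedding

/-! ### The skew field of the operators is `𝒟₂,₂(k)`. -/

section WeylSkewField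

open Algebra

variable {k : Type*} [Field k]

/-- A differential operator as an element of `LaurentOps`. -/
def opsMk (t : Module.End k (Laurent4 k)) (h : t ∈ laurentDiffOps k) : LaurentOps k := ⟨t, h⟩

/-- The variable `j` as a differential operator. -/
noncomputable def opsVar (k : Type*) [Field k] (j : Fin 4) : LaurentOps k :=
  opsMk (mulOp k (lvar k j)) (mulOp_lvar_mem_laurentDiffOps j)

theorem opsToEnd_opsVar (j : Fin 4) : opsToEnd k (opsVar k j) = mulOp k (lvar k j) := rfl

theorem eulerEnd_mem_laurentDiffOps (i : Fin 2) :
    eulerEnd k (Fin.castAdd 2 i) ∈ laurentDiffOps k := by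
  fin_cases i
  exacts [eulerEnd_zero_mem, eulerEnd_one_mem]

/-- The partial derivative with respect to one of the first two variables. -/
noncomputable def opsPartial (k : Type*) [Field k] (i : Fin 2) : LaurentOps k :=
  opsMk (mulOp k (lvarInv k (Fin.castAdd 2 i)) * eulerEnd k (Fin.castAdd 2 i))
    (mul_mem (mulOp_lvarInv_mem_laurentDiffOps _) (eulerEnd_mem_laurentDiffOps i))

theorem opsToEnd_opsPartial (i : Fin 2) : opsToEnd k (opsPartial k i) =
    mulOp k (lvarInv k (Fin.castAdd 2 i)) * eulerEnd k (Fin.castAdd 2 i) := rfl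

theorem opsVar_commute (i j : Fin 4) : opsVar k i * opsVar k j = opsVar k j * opsVar k i :=
  opsToEnd_injective (by simp only [map_mul, opsToEnd_opsVar, mulOp_commute])

/-- Only `E₀` and `E₁` are among the generating operators, and they annihilate `X₂` and `X₃`. -/
theorem opsVar_central (i : Fin 2) (a : LaurentOps k) :
    opsVar k (Fin.natAdd 2 i) * a = a * opsVar k (Fin.natAdd 2 i) := by
  have key : ∀ t ∈ laurentDiffOps k, t * mulOp k (lvar k (Fin.natAdd 2 i)) =
      mulOp k (lvar k (Fin.natAdd 2 i)) * t := by
    intro t ht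
    have hE (j : Fin 4) (hj : j ≠ Fin.natAdd 2 i) :
        eulerEnd k j * mulOp k (lvar k (Fin.natAdd 2 i)) =
          mulOp k (lvar k (Fin.natAdd 2 i)) * eulerEnd k j := by
      rw [eulerEnd_mul_mulOp, euler_lvar, if_neg hj, map_zero, add_zero]
    refine commute_map_of_mem_adjoin (AlgHom.id k _) ?_ ht
    rintro _ (rfl | rfl | ⟨f, -, rfl⟩)
    · refine hE _ ?_
      fin_cases i <;> decide
    · refine hE _ ?_
      fin_cases i <;> decide
    · exact mulOp_commute _ _
  apply opsToEnd_injective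
  rw [map_mul, map_mul, opsToEnd_opsVar, key _ (opsToEnd_mem a)]

theorem opsPartial_opsVar (i : Fin 2) (j : Fin 2) :
    opsPartial k i * opsVar k (Fin.castAdd 2 j) - opsVar k (Fin.castAdd 2 j) * opsPartial k i =
      if i = j then 1 else 0 := by
  apply opsToEnd_injective
  rw [map_sub, map_mul, map_mul, opsToEnd_opsVar, opsToEnd_opsPartial, ← derEnd_smul_euler,
    derEnd_mul_mulOp, add_sub_cancel_left, Derivation.smul_apply, euler_lvar]
  rcases eq_or_ne i j with rfl | h
  · rw [if_pos rfl, if_pos rfl, smul_eq_mul, mul_comm, lvar_mul_lvarInv, map_one, map_one]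
  · rw [if_neg h, if_neg fun h' => h (Fin.castAdd_injective 2 2 h'), smul_zero, map_zero,
      map_zero]

theorem opsPartial_commute (i j : Fin 2) :
    opsPartial k i * opsPartial k j = opsPartial k j * opsPartial k i := by
  rcases eq_or_ne i j with rfl | hij
  · rfl
  have hE (i j : Fin 2) (hij : i ≠ j) :
      eulerEnd k (Fin.castAdd 2 i) * mulOp k (lvarInv k (Fin.castAdd 2 j)) =
        mulOp k (lvarInv k (Fin.castAdd 2 j)) * eulerEnd k (Fin.castAdd 2 i) := by
    rw [eulerEnd_mul_mulOp, euler_lvarInv, if_neg fun h => hij (Fin.castAdd_injective 2 2 h),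
      map_zero, add_zero]
  apply opsToEnd_injective
  rw [map_mul, map_mul, opsToEnd_opsPartial, opsToEnd_opsPartial, mul_assoc,
    ← mul_assoc (eulerEnd k _), hE i j hij, mul_assoc, mul_assoc, ← mul_assoc (eulerEnd k _),
    hE j i hij.symm, mul_assoc, eulerEnd_commute, ← mul_assoc, mulOp_commute, mul_assoc]

theorem SkewFrac.mem_center {A : Type*} [Ring A] [Algebra k A] [IsNoetherianDomain A] {z : A}
    (h : ∀ a, z * a = a * z) : toSkewFrac k A z ∈ Subring.center (SkewFrac A) := by
  rw [Subring.mem_center_iff]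
  intro w
  obtain ⟨r, s, rfl⟩ := SkewFrac.exists_eq_inv_mul (k := k) w
  have hc (a : A) : Commute (toSkewFrac k A a) (toSkewFrac k A z) := by
    rw [Commute, SemiconjBy, ← map_mul, ← map_mul, h]
  exact ((hc s).inv_left₀.mul_left (hc r)).eq

variable [CharZero k]

theorem isWeylSystem_ops : IsWeylSystem (fun i => toSkewFrac k _ (opsPartial k i))
    (fun i => toSkewFrac k _ (opsVar k (Fin.castAdd 2 i))) where
  p_q i j := by
    rw [← map_mul, ← map_mul, ← map_sub, opsPartial_opsVar]
    split_ifs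
    exacts [map_one _, map_zero _]
  p_p i j := by rw [← map_mul, opsPartial_commute, map_mul]
  q_q i j := by rw [← map_mul, opsVar_commute, map_mul]

/-- The embedding of the polynomial ring in the central variables. -/
noncomputable def centralPoly (k : Type*) [Field k] [CharZero k] :
    MvPolynomial (Fin 2) k →+* Subring.center (LaurentSkewField k) :=
  MvPolynomial.eval₂Hom
    ((algebraMap k (LaurentSkewField k)).codRestrict (Subring.center (LaurentSkewField k))
      fun r => Subring.mem_center_iff.2 fun w => (Algebra.commutes r w).symm)
    fun i => ⟨toSkewFrac k _ (opsVar k (Fin.natAdd 2 i)), SkewFrac.mem_center (opsVar_central i)⟩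

theorem centralPoly_C (r : k) :
    (centralPoly k (MvPolynomial.C r) : LaurentSkewField k) = algebraMap k _ r := by
  simp [centralPoly]

theorem centralPoly_X (i : Fin 2) : (centralPoly k (MvPolynomial.X i) : LaurentSkewField k) =
    toSkewFrac k _ (opsVar k (Fin.natAdd 2 i)) := by
  simp [centralPoly]

/-- Algebraic independence of `X₂, X₃`, by the same device: each variable is detected by its partial
derivative. -/
theorem aeval_lvar_injective : Function.Injective
    (MvPolynomial.aeval (R := k) fun i : Fin 2 => lvar k (Fin.natAdd 2 i)) := by
  let φ : MvPolynomial (Fin 2) k →ₐ[k] Module.End k (Laurent4 k) :=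
    (mulOp k).comp (MvPolynomial.aeval fun i : Fin 2 => lvar k (Fin.natAdd 2 i))
  have hX (i : Fin 2) : φ (MvPolynomial.X i) = mulOp k (lvar k (Fin.natAdd 2 i)) := by simp [φ]
  have key : ∀ S : Finset (Fin 2), ∀ p ∈ adjoin k (MvPolynomial.X '' (S : Set (Fin 2))),
      φ p = 0 → p = 0 := by
    intro S
    induction S using Finset.induction_on with
    | empty =>
      intro p hp h0
      rw [Finset.coe_empty, Set.image_empty, adjoin_empty, Algebra.mem_bot] at hp
      obtain ⟨r, rfl⟩ := hp
      rw [AlgHom.commutes] at h0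
      rw [(map_eq_zero_iff _ (algebraMap k (Module.End k (Laurent4 k))).injective).1 h0, map_zero]
    | insert i S hi ih =>
      rw [Finset.coe_insert, Set.image_insert_eq]
      refine eq_zero_of_mem_adjoin_insert φ ih
        (fun a ha => .of_commute (subset_adjoin ha) (mul_comm _ _))
        (derEnd (lvarInv k (Fin.natAdd 2 i) • euler k (Fin.natAdd 2 i))) 1 ?_ ?_ (by simp)
        isUnit_one
      · rintro _ ⟨j, hj, rfl⟩
        rw [hX]
        refine derEnd_commute_mulOp ?_
        rw [Derivation.smul_apply, euler_lvar, if_neg, smul_zero]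
        intro h
        rw [Fin.natAdd_inj] at h
        exact hi (h ▸ hj)
      · rw [hX, derEnd_mul_mulOp, add_sub_cancel_left, Derivation.smul_apply, euler_lvar,
          if_pos rfl, smul_eq_mul, mul_comm, lvar_mul_lvarInv, map_one]
  rw [injective_iff_map_eq_zero]
  intro p hp
  refine key Finset.univ p ?_ ?_
  · rw [Finset.coe_univ, Set.image_univ, MvPolynomial.adjoin_range_X]
    exact mem_top
  · exact (congrArg (mulOp k) hp).trans (map_zero _)

/-- The map factors through multiplication operators. Injectivity is what extends it to `k(z₁, z₂)`
and makes the skew field an algebra over that field. -/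
theorem centralPoly_injective : Function.Injective (centralPoly k) := by
  let f : MvPolynomial (Fin 2) k →ₐ[k] LaurentOps k :=
    liftToOps ((mulOp k).comp (MvPolynomial.aeval fun i : Fin 2 => lvar k (Fin.natAdd 2 i)))
      fun p => mulOp_mem_laurentDiffOps (by
        have hle : adjoin k (Set.range fun i : Fin 2 => lvar k (Fin.natAdd 2 i)) ≤
            adjoin k (Set.range (lvar k) ∪ Set.range (lvarInv k)) := adjoin_mono (by
          rintro _ ⟨i, rfl⟩
          exact .inl ⟨_, rfl⟩)
        refine hle ?_
        rw [adjoin_range_eq_range_aeval]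
        exact ⟨p, rfl⟩)
  have hf : Function.Injective f := by
    have h : Function.Injective (opsToEnd k ∘ f) := mulOp_injective.comp aeval_lvar_injective
    exact h.of_comp
  have h : ∀ p, (centralPoly k p : LaurentSkewField k) = toSkewFrac k _ (f p) := by
    have h1 : (Subring.center (LaurentSkewField k)).subtype.comp (centralPoly k) =
        (toSkewFrac k (LaurentOps k)).toRingHom.comp f.toRingHom := by
      refine MvPolynomial.ringHom_ext (fun r => ?_) fun i => ?_
      · refine (centralPoly_C r).trans ?_
        exact (((toSkewFrac k (LaurentOps k)).comp f).commutes r).symm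
      · refine (centralPoly_X i).trans (congrArg (toSkewFrac k (LaurentOps k)) ?_)
        apply opsToEnd_injective
        change _ = mulOp k (MvPolynomial.aeval _ (MvPolynomial.X i))
        rw [MvPolynomial.aeval_X, opsToEnd_opsVar]
    exact fun p => congrArg (fun g => g p) h1
  intro p q hpq
  refine hf (toSkewFrac_injective (k := k) ?_)
  rw [← h, ← h, hpq]

noncomputable instance : Field (Subring.center (LaurentSkewField k)) := Subring.instField

/-- The embedding of the field of rational functions in the central variables. -/
noncomputable def centralRatFunc (k : Type*) [Field k] [CharZero k] :
    RatFuncField 2 k →+* Subring.center (LaurentSkewField k) :=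
  IsFractionRing.lift (centralPoly_injective (k := k))

noncomputable instance : Algebra (RatFuncField 2 k) (LaurentSkewField k) :=
  ((Subring.center (LaurentSkewField k)).subtype.comp (centralRatFunc k)).toAlgebra'
    fun c x => (Subring.mem_center_iff.1 (centralRatFunc k c).prop x).symm

theorem algebraMap_ratFuncField (p : MvPolynomial (Fin 2) k) :
    algebraMap (RatFuncField 2 k) (LaurentSkewField k) (algebraMap _ _ p) = centralPoly k p :=
  congrArg Subtype.val (IsFractionRing.lift_algebraMap (centralPoly_injective (k := k)) p)

instance : IsScalarTower k (RatFuncField 2 k) (LaurentSkewField k) :=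
  .of_algebraMap_eq fun r => by
    rw [IsScalarTower.algebraMap_apply k (MvPolynomial (Fin 2) k) (RatFuncField 2 k),
      algebraMap_ratFuncField, MvPolynomial.algebraMap_eq, centralPoly_C]

instance : CharZero (RatFuncField 2 k) :=
  charZero_of_injective_algebraMap (algebraMap k (RatFuncField 2 k)).injective

instance weylAlgebra_ratFuncField_isNoetherianDomain :
    IsNoetherianDomain (WeylAlgebra 2 (RatFuncField 2 k)) :=
  weylAlgebra_isNoetherianDomain (isWeylSystem_ops (k := k))

/-- The Weyl skew field as the skew field of fractions of an algebra of differential operators. -/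
noncomputable def weylSkewFieldEquiv (k : Type*) [Field k] [CharZero k] :
    WeylSkewField 2 2 k ≃ₐ[k] LaurentSkewField k :=
  skewFracEquiv ((weylLift (RatFuncField 2 k) (isWeylSystem_ops (k := k))).restrictScalars k)
    (weylLift_injective _) fun F h => by
      have hK (c : RatFuncField 2 k) : algebraMap _ (LaurentSkewField k) c ∈ F := by
        rw [← (weylLift (RatFuncField 2 k) (isWeylSystem_ops (k := k))).commutes c]
        exact h _
      have hF (r : k) : algebraMap k (LaurentSkewField k) r ∈ F := by
        rw [IsScalarTower.algebraMap_apply k (RatFuncField 2 k)]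
        exact hK _
      have hq (i : Fin 2) : mulOp k (lvar k (Fin.castAdd 2 i)) ∈ opsInSubfield F hF := by
        have := h (wgen _ (.q i))
        rw [AlgHom.restrictScalars_apply, weylLift_wgen] at this
        exact mem_opsInSubfield.2 this
      have hz (i : Fin 2) : mulOp k (lvar k (Fin.natAdd 2 i)) ∈ opsInSubfield F hF := by
        have := hK (algebraMap (MvPolynomial (Fin 2) k) _ (MvPolynomial.X i))
        rw [algebraMap_ratFuncField, centralPoly_X] at this
        exact mem_opsInSubfield.2 this
      -- `Eᵢ = Xᵢ∂ᵢ` is the product of the images of `q i` and `p i`.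
      have hE (i : Fin 2) : eulerEnd k (Fin.castAdd 2 i) ∈ opsInSubfield F hF := by
        have := h (wgen _ (.p i))
        rw [AlgHom.restrictScalars_apply, weylLift_wgen] at this
        have hp := mul_mem (hq i) (mem_opsInSubfield (hF := hF).2 this)
        rwa [opsToEnd_opsPartial, ← mul_assoc, ← map_mul, lvar_mul_lvarInv, map_one,
          one_mul] at hp
      refine subfield_eq_top_of_mem_opsInSubfield (hF := hF) (fun j => ?_) (hE 0) (hE 1)
      fin_cases j
      exacts [hq 0, hq 1, hz 0, hz 1]

end WeylSkewField

theorem corollary4p10 (k : Type*) [Field k] [IsAlgClosed k] [CharZero k] :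
    FracIsoWeylSkewField k (JordanDouble k) 2 2 ∧
      GelfandKirillovProperty k (JordanDouble k) := by
  have h : FracIsoWeylSkewField k (JordanDouble k) 2 2 :=
    ⟨inferInstance, inferInstance, ⟨(jordanSkewFracEquiv k).trans (weylSkewFieldEquiv k).symm⟩⟩
  exact ⟨h, 2, 2, one_le_two, h⟩
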